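/- Let $\Gamma$ be a subgroup of $\mathrm{SL}(2,\mathbb C)$ containing at least one matrix $\begin{pmatrix} a&b\\ c&d\end{pmatrix}$ with $c\neq 0$. Let $R$ be a commutative $\mathbb C$-algebra of functions of one variable $z$ (functions holomorphic on a dense open subset of a fixed open set $\Omega\subseteq\mathbb C$ which is stable under the homographies of $\Gamma$ away from their poles, two functions being identified when they agree on a dense open subset of $\Omega$) which is a domain, on which $\Gamma$ acts on the right by $(f\cdot\gamma)(z)=f\left(\frac{az+b}{cz+d}\right)$, which contains $s_\gamma: z\mapsto cz+d$ as an invertible element for every $\gamma=\begin{pmatrix} a&b\\ c&d\end{pmatrix}\in\Gamma$, and which is stable under $\partial_z=\frac{d}{dz}$. Write $f^{(n)}=\partial_z^nf$ and, for $m\in\mathbb Z$, $(f|_m\gamma)(z)=(cz+d)^{-m}f\left(\frac{az+b}{cz+d}\right)$. Let $\delta=-\frac12\partial_z$ and let $C=R((y;\delta))_2$ be the ring of Laurent series $\sum_{i\ge i_0}f_iy^i$ ($i_0\in\mathbb Z$, $f_i\in R$) with the noncommutative multiplication determined by $$y^if=\sum_{n\ge 0}\frac{i(i+2)\cdots(i+2n-2)}{n!}\,\delta^n(f)\,y^{i+2n}\qquad(i\in\mathbb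 Z,\ f\in R).$$ The group $\Gamma$ acts on $C$ by $\left(\sum f_iy^i\right)\cdot\gamma=\sum (f_i\cdot\gamma)(y\cdot\gamma)^i$, where $y\cdot\gamma=(cz+d)^{-1}y+\cdots$ is the unique square root in $C$ of $y^2(cz+d)^{-2}$ whose term of minimal valuation is $(cz+d)^{-1}y$. For $m\in\mathbb Z$ and a $\mathbb C$-linear map $\psi:R\to C$, consider the conditions * (C1) $\psi(f|_m\gamma)=\psi(f)\cdot\gamma$ for all $f\in R$, $\gamma\in\Gamma$; * (C2) there is a sequence $(\alpha(n))_{n\ge0}$ of complex numbers such that $\psi(f)=\sum_{n\ge0}\alpha(n)f^{(n)}y^{m+2n}$ for all $f\in R$; * (C3) (C2) holds with $\alpha(0)=1$. For $m\geq 1$ let $\psi_m(f)=\sum_{n\ge0}\frac{(-1)^n}{4^nn!}\left(\prod_{i=0}^{n-1}\frac{(m+2i)(m+2i+2)}{m+i}\right)f^{(n)}y^{m+2n}$. Let $k$ be a positive integer. Then there is no linear map $R\to C$ satisfying (C1), (C2) and (C3) for $m=-2k+1$. More precisely, the map $f\mapsto\psi_{2k+1}(f^{(2k)})$ is nonzero,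 satisfies (C1) and (C2) for $m=-2k+1$, does not satisfy (C3), and every linear map $R\to C$ satisfying (C1) and (C2) for $m=-2k+1$ is a complex multiple of it. -/

import Mathlib

namespace QuadPDO

set_option linter.unusedSectionVars false

section Ring

variable {R : Type*} [CommRing R] [Algebra ℂ R]

/-- The derivation `δ` of `R` applied to each coefficient of a Laurent series. -/
noncomputable def coeffDeriv (δ : Derivation ℂ R R) : LaurentSeries R →+ LaurentSeries R where
  toFun p := HahnSeries.map p (δ : R →ₗ[ℂ] R).toAddMonoidHom
  map_zero' := by ext n; simp
  map_add' p q := by ext n; simp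

@[simp] theorem coeffDeriv_coeff (δ : Derivation ℂ R R) (p : LaurentSeries R) (n : ℤ) :
    (coeffDeriv δ p).coeff n = δ (p.coeff n) := by
  simp [coeffDeriv]

theorem coeffDeriv_mul (δ : Derivation ℂ R R) (p q : LaurentSeries R) :
    coeffDeriv δ (p * q) = coeffDeriv δ p * q + p * coeffDeriv δ q := by
  ext n
  rw [HahnSeries.coeff_add, coeffDeriv_coeff, HahnSeries.coeff_mul,
    HahnSeries.coeff_mul_left' (x := coeffDeriv δ p) (y := q) p.isPWO_support
      (fun m hm hq => hm (by simp [hq])),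
    HahnSeries.coeff_mul_right' (x := p) (y := coeffDeriv δ q) q.isPWO_support
      (fun m hm hq => hm (by simp [hq])),
    ← Finset.sum_add_distrib, map_sum]
  refine Finset.sum_congr rfl fun ij _ => ?_
  simp only [coeffDeriv_coeff, Derivation.leibniz, smul_eq_mul]
  ring

/-- The number `i (i + 2) ⋯ (i + 2k - 2) / k!`: the coefficient of `δᵏ(f) y^(i + 2k)` in the
expansion of `yⁱ f`. -/
noncomputable def qcoef (i : ℤ) (k : ℕ) : ℂ :=
  ∏ j ∈ Finset.range k, (((i : ℂ) + 2 * (j : ℂ)) / ((j : ℂ) + 1))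

/-- `qshift k` replaces each term `f yⁱ` by `qcoef i k • f y^(i + 2k)`. -/
noncomputable def qshift (k : ℕ) (p : LaurentSeries R) : LaurentSeries R :=
  HahnSeries.ofSuppBddBelow
    (fun n => qcoef (n - 2 * k) k • p.coeff (n - 2 * k)) (by
      refine ⟨p.order, fun n hn => ?_⟩
      by_contra hlt
      refine hn ?_
      have : p.coeff (n - 2 * k) = 0 := HahnSeries.coeff_eq_zero_of_lt_order (by lia)
      simp [this])

@[simp] theorem qshift_coeff (k : ℕ) (p : LaurentSeries R) (n : ℤ) :
    (qshift k p).coeff n = qcoef (n - 2 * k) k • p.coeff (n - 2 * k) := rfl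

/-- The map `y³ d/dy` on Laurent series: `f yⁿ ↦ n f y^(n + 2)`. -/
noncomputable def yDeriv : LaurentSeries R →+ LaurentSeries R where
  toFun p := HahnSeries.ofSuppBddBelow (fun n => (n - 2) • p.coeff (n - 2)) (by
      refine ⟨p.order, fun n hn => ?_⟩
      by_contra hlt
      refine hn ?_
      have : p.coeff (n - 2) = 0 := HahnSeries.coeff_eq_zero_of_lt_order (by lia)
      simp [this])
  map_zero' := by ext n; simp
  map_add' p q := by
    ext n
    simp

theorem yDeriv_coeff (p : LaurentSeries R) (n : ℤ) :
    (yDeriv p).coeff n = (n - 2) • p.coeff (n - 2) := rfl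

theorem yDeriv_mul (p q : LaurentSeries R) :
    yDeriv (p * q) = yDeriv p * q + p * yDeriv q := by
  -- reduce to the Euler operator `y d/dy`
  let E : LaurentSeries R → LaurentSeries R := fun p =>
    HahnSeries.ofSuppBddBelow (fun n => n • p.coeff n) (by
      refine ⟨p.order, fun n hn => ?_⟩
      by_contra hlt
      refine hn ?_
      have : p.coeff n = 0 := HahnSeries.coeff_eq_zero_of_lt_order (by lia)
      simp [this])
  have hE : ∀ (p : LaurentSeries R) (n : ℤ), (E p).coeff n = n • p.coeff n := fun _ _ => rfl
  have hD : ∀ p : LaurentSeries R, yDeriv p = HahnSeries.single (2 : ℤ) (1 : R) * E p := by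
    intro p
    ext n
    rw [HahnSeries.coeff_single_mul, one_mul, hE, yDeriv_coeff]
  have hL : E (p * q) = E p * q + p * E q := by
    ext n
    rw [HahnSeries.coeff_add, hE, HahnSeries.coeff_mul,
      HahnSeries.coeff_mul_left' (x := E p) (y := q) p.isPWO_support
        (fun m hm hq => hm (by simp [hE, hq])),
      HahnSeries.coeff_mul_right' (x := p) (y := E q) q.isPWO_support
        (fun m hm hq => hm (by simp [hE, hq])),
      ← Finset.sum_add_distrib, Finset.smul_sum]
    refine Finset.sum_congr rfl fun ij hij => ?_
    rw [Finset.mem_antidiagonal] at hij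
    rw [hE, hE, ← hij.2.2, add_smul, smul_mul_assoc, mul_smul_comm]
  rw [hD, hD, hD, hL]
  ring

theorem qcoef_succ (i : ℤ) (k : ℕ) :
    qcoef i (k + 1) = qcoef i k * (((i : ℂ) + 2 * (k : ℂ)) / ((k : ℂ) + 1)) := by
  rw [qcoef, Finset.prod_range_succ, ← qcoef]

theorem qshift_zero (p : LaurentSeries R) : qshift 0 p = p := by
  ext n; simp [qcoef]

theorem qshift_succ (k : ℕ) (p : LaurentSeries R) :
    (k + 1) • qshift (k + 1) p = yDeriv (qshift k p) := by
  ext n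
  have hk : (k : ℂ) + 1 ≠ 0 := Nat.cast_add_one_ne_zero k
  have e : n - 2 - 2 * (k : ℤ) = n - 2 * ((k + 1 : ℕ) : ℤ) := by push_cast; ring
  rw [HahnSeries.coeff_smul, yDeriv_coeff, qshift_coeff, qshift_coeff, e,
    ← Nat.cast_smul_eq_nsmul ℂ, ← Int.cast_smul_eq_zsmul ℂ, smul_smul, smul_smul, qcoef_succ]
  congr 1
  push_cast
  field_simp
  ring

theorem nsmul_cancel (k : ℕ) {p q : LaurentSeries R} (h : (k + 1) • p = (k + 1) • q) : p = q := by
  ext n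
  have hk : ((k + 1 : ℕ) : ℂ) ≠ 0 := Nat.cast_ne_zero.2 (Nat.succ_ne_zero k)
  have := congrArg (fun x : LaurentSeries R => x.coeff n) h
  simp only [HahnSeries.coeff_smul] at this
  rw [← Nat.cast_smul_eq_nsmul ℂ, ← Nat.cast_smul_eq_nsmul ℂ] at this
  exact (smul_right_injective R hk) this

theorem qshift_add (k : ℕ) (p q : LaurentSeries R) :
    qshift k (p + q) = qshift k p + qshift k q := by
  ext n; simp

theorem qshift_sum {ι : Type*} (k : ℕ) (s : Finset ι) (f : ι → LaurentSeries R) :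
    qshift k (∑ i ∈ s, f i) = ∑ i ∈ s, qshift k (f i) := by
  classical
  induction s using Finset.induction_on with
  | empty => ext n; simp
  | insert a s ha ih => rw [Finset.sum_insert ha, Finset.sum_insert ha, qshift_add, ih]

theorem qshift_mul (k : ℕ) (p q : LaurentSeries R) :
    qshift k (p * q) =
      ∑ ab ∈ Finset.HasAntidiagonal.antidiagonal k, qshift ab.1 p * qshift ab.2 q := by
  induction k with
  | zero => simp [qshift_zero]
  | succ k ih =>
    refine nsmul_cancel k ?_
    have h1 : (k + 1) • ∑ ab ∈ Finset.HasAntidiagonal.antidiagonal (k + 1),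
          qshift ab.1 p * qshift ab.2 q
        = (∑ ab ∈ Finset.HasAntidiagonal.antidiagonal (k + 1),
            ab.1 • (qshift ab.1 p * qshift ab.2 q))
        + ∑ ab ∈ Finset.HasAntidiagonal.antidiagonal (k + 1),
            ab.2 • (qshift ab.1 p * qshift ab.2 q) := by
      rw [Finset.smul_sum, ← Finset.sum_add_distrib]
      refine Finset.sum_congr rfl fun ab hab => ?_
      rw [Finset.HasAntidiagonal.mem_antidiagonal] at hab
      rw [← add_smul, hab]
    rw [h1, qshift_succ, ih, map_sum, Finset.Nat.sum_antidiagonal_succ,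
      Finset.Nat.sum_antidiagonal_succ']
    simp only [zero_smul, zero_add, ← Finset.sum_add_distrib]
    refine Finset.sum_congr rfl fun ab _ => ?_
    rw [yDeriv_mul, ← qshift_succ, ← qshift_succ, smul_mul_assoc, mul_smul_comm]

theorem qshift_qshift (a b : ℕ) (p : LaurentSeries R) :
    qshift a (qshift b p) = (a + b).choose a • qshift (a + b) p := by
  induction a with
  | zero => simp [qshift_zero]
  | succ a ih =>
    refine nsmul_cancel a ?_
    rw [qshift_succ, ih, map_nsmul, ← qshift_succ, smul_smul, smul_smul,
      show a + 1 + b = a + b + 1 by ring]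
    congr 1
    have := Nat.add_one_mul_choose_eq (a + b) a
    linarith

theorem coeffDeriv_qshift (δ : Derivation ℂ R R) (k : ℕ) (p : LaurentSeries R) :
    coeffDeriv δ (qshift k p) = qshift k (coeffDeriv δ p) := by
  ext n; simp

theorem coeffDeriv_iter_qshift (δ : Derivation ℂ R R) (j k : ℕ) (p : LaurentSeries R) :
    (coeffDeriv δ)^[j] (qshift k p) = qshift k ((coeffDeriv δ)^[j] p) := by
  induction j with
  | zero => rfl
  | succ j ih => rw [Function.iterate_succ_apply', ih, coeffDeriv_qshift,
      ← Function.iterate_succ_apply' (f := coeffDeriv δ)]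

theorem coeffDeriv_iter_mul (δ : Derivation ℂ R R) (k : ℕ) (p q : LaurentSeries R) :
    (coeffDeriv δ)^[k] (p * q) = ∑ ab ∈ Finset.HasAntidiagonal.antidiagonal k,
      k.choose ab.1 • ((coeffDeriv δ)^[ab.1] p * (coeffDeriv δ)^[ab.2] q) := by
  induction k with
  | zero => simp
  | succ k ih =>
    rw [Function.iterate_succ_apply', ih, map_sum,
      Finset.sum_antidiagonal_choose_succ_nsmul
        (fun a b => (coeffDeriv δ)^[a] p * (coeffDeriv δ)^[b] q), ← Finset.sum_add_distrib]
    refine Finset.sum_congr rfl fun ab hab => ?_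
    rw [Finset.HasAntidiagonal.mem_antidiagonal] at hab
    rw [map_nsmul, coeffDeriv_mul, smul_add, add_comm, Nat.choose_symm_of_eq_add hab.symm]
    simp only [Function.iterate_succ_apply']

/-- The series `p` has no term below `yᵃ`. -/
def OrdGE (a : ℤ) (p : LaurentSeries R) : Prop := ∀ n < a, p.coeff n = 0

theorem exists_ordGE (p : LaurentSeries R) : ∃ a, OrdGE a p :=
  ⟨p.order, fun _ hn => HahnSeries.coeff_eq_zero_of_lt_order hn⟩

theorem OrdGE.mono {a b : ℤ} {p : LaurentSeries R} (h : OrdGE b p) (hab : a ≤ b) : OrdGE a p :=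
  fun n hn => h n (hn.trans_le hab)

theorem OrdGE.add {a : ℤ} {p q : LaurentSeries R} (hp : OrdGE a p) (hq : OrdGE a q) :
    OrdGE a (p + q) := fun n hn => by simp [hp n hn, hq n hn]

theorem OrdGE.sub {a : ℤ} {p q : LaurentSeries R} (hp : OrdGE a p) (hq : OrdGE a q) :
    OrdGE a (p - q) := fun n hn => by simp [hp n hn, hq n hn]

theorem OrdGE.nsmul {a : ℤ} {p : LaurentSeries R} (hp : OrdGE a p) (k : ℕ) :
    OrdGE a (k • p) := fun n hn => by rw [HahnSeries.coeff_smul, hp n hn, smul_zero]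

theorem ordGE_sum {ι : Type*} {a : ℤ} (s : Finset ι) (f : ι → LaurentSeries R)
    (h : ∀ i ∈ s, OrdGE a (f i)) : OrdGE a (∑ i ∈ s, f i) := fun n hn => by
  rw [HahnSeries.coeff_sum]
  exact Finset.sum_eq_zero fun i hi => h i hi n hn

theorem OrdGE.cmul {a b : ℤ} {p q : LaurentSeries R} (hp : OrdGE a p) (hq : OrdGE b q) :
    OrdGE (a + b) (p * q) := fun n hn => by
  rw [HahnSeries.coeff_mul]
  refine Finset.sum_eq_zero fun ij hij => ?_
  rw [Finset.mem_antidiagonal] at hij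
  rcases lt_or_ge ij.1 a with h | h
  · rw [hp _ h, zero_mul]
  · rw [hq ij.2 (by lia), mul_zero]

theorem OrdGE.qshift {a : ℤ} {p : LaurentSeries R} (hp : OrdGE a p) (k : ℕ) :
    OrdGE (a + 2 * k) (qshift k p) := fun n hn => by
  rw [qshift_coeff, hp _ (by lia), smul_zero]

theorem OrdGE.deriv {a : ℤ} {p : LaurentSeries R} (hp : OrdGE a p) (δ : Derivation ℂ R R)
    (k : ℕ) : OrdGE a ((coeffDeriv δ)^[k] p) := by
  induction k with
  | zero => exact hp
  | succ k ih =>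
    intro n hn
    rw [Function.iterate_succ_apply', coeffDeriv_coeff, ih n hn, map_zero]

/-- The `k`-th term `∑ᵢ fᵢ (qcoef i k δᵏ(g) y^(i + 2k))` of the product of `∑ᵢ fᵢ yⁱ` and `g`. -/
noncomputable def mulTerm (δ : Derivation ℂ R R) (k : ℕ) (p q : LaurentSeries R) :
    LaurentSeries R :=
  qshift k p * (coeffDeriv δ)^[k] q

theorem OrdGE.mulTerm {a b : ℤ} {p q : LaurentSeries R} (hp : OrdGE a p) (hq : OrdGE b q)
    (δ : Derivation ℂ R R) (k : ℕ) : OrdGE (a + b + 2 * k) (mulTerm δ k p q) :=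
  ((hp.qshift k).cmul (hq.deriv δ k)).mono (by lia)

/-- The product of the ring `R((y ; δ))₂`: `p q = ∑ₖ mulTerm δ k p q`. -/
noncomputable def qmul (δ : Derivation ℂ R R) (p q : LaurentSeries R) : LaurentSeries R :=
  HahnSeries.ofSuppBddBelow (fun n => ∑ᶠ k : ℕ, (mulTerm δ k p q).coeff n) (by
    obtain ⟨a, ha⟩ := exists_ordGE p
    obtain ⟨b, hb⟩ := exists_ordGE q
    refine ⟨a + b, fun n hn => ?_⟩
    by_contra hlt
    refine hn ?_
    have : ∀ k : ℕ, (mulTerm δ k p q).coeff n = 0 := fun k => ha.mulTerm hb δ k n (by lia)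
    simp [this])

theorem qmul_coeff (δ : Derivation ℂ R R) {a b : ℤ} {p q : LaurentSeries R} (hp : OrdGE a p)
    (hq : OrdGE b q) (n : ℤ) (K : ℕ) (hK : n < a + b + 2 * K) :
    (qmul δ p q).coeff n = (∑ k ∈ Finset.range K, mulTerm δ k p q).coeff n := by
  rw [HahnSeries.coeff_sum]
  refine finsum_eq_sum_of_support_subset _ fun k hk => ?_
  by_contra hlt
  refine hk (hp.mulTerm hq δ k n ?_)
  have : K ≤ k := by simpa using hlt
  lia

theorem OrdGE.qmul {a b : ℤ} {p q : LaurentSeries R} (hp : OrdGE a p) (hq : OrdGE b q)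
    (δ : Derivation ℂ R R) : OrdGE (a + b) (qmul δ p q) := fun n hn => by
  rw [qmul_coeff δ hp hq n 0 (by simpa using hn)]
  simp

theorem mulTerm_add_left (δ : Derivation ℂ R R) (k : ℕ) (p p' q : LaurentSeries R) :
    mulTerm δ k (p + p') q = mulTerm δ k p q + mulTerm δ k p' q := by
  simp [mulTerm, qshift_add, add_mul]

theorem coeffDeriv_iter_add (δ : Derivation ℂ R R) (k : ℕ) (p q : LaurentSeries R) :
    (coeffDeriv δ)^[k] (p + q) = (coeffDeriv δ)^[k] p + (coeffDeriv δ)^[k] q :=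
  iterate_map_add (coeffDeriv δ) k p q

theorem mulTerm_add_right (δ : Derivation ℂ R R) (k : ℕ) (p q q' : LaurentSeries R) :
    mulTerm δ k p (q + q') = mulTerm δ k p q + mulTerm δ k p q' := by
  simp [mulTerm, mul_add]

theorem exists_bound (a n : ℤ) : ∃ K : ℕ, n < a + 2 * K := ⟨(n - a + 1).toNat, by lia⟩

theorem qmul_add_left (δ : Derivation ℂ R R) (p p' q : LaurentSeries R) :
    qmul δ (p + p') q = qmul δ p q + qmul δ p' q := by
  obtain ⟨a, ha⟩ := exists_ordGE p
  obtain ⟨a', ha'⟩ := exists_ordGE p'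
  obtain ⟨b, hb⟩ := exists_ordGE q
  have h1 := ha.mono (min_le_left a a')
  have h2 := ha'.mono (min_le_right a a')
  ext n
  obtain ⟨K, hK⟩ := exists_bound (min a a' + b) n
  rw [HahnSeries.coeff_add, qmul_coeff δ h1 hb n K hK, qmul_coeff δ h2 hb n K hK,
    qmul_coeff δ (h1.add h2) hb n K hK, ← HahnSeries.coeff_add, ← Finset.sum_add_distrib]
  simp only [mulTerm_add_left]

theorem qmul_add_right (δ : Derivation ℂ R R) (p q q' : LaurentSeries R) :
    qmul δ p (q + q') = qmul δ p q + qmul δ p q' := by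
  obtain ⟨a, ha⟩ := exists_ordGE p
  obtain ⟨b, hb⟩ := exists_ordGE q
  obtain ⟨b', hb'⟩ := exists_ordGE q'
  have h1 := hb.mono (min_le_left b b')
  have h2 := hb'.mono (min_le_right b b')
  ext n
  obtain ⟨K, hK⟩ := exists_bound (a + min b b') n
  rw [HahnSeries.coeff_add, qmul_coeff δ ha h1 n K hK, qmul_coeff δ ha h2 n K hK,
    qmul_coeff δ ha (h1.add h2) n K hK, ← HahnSeries.coeff_add, ← Finset.sum_add_distrib]
  simp only [mulTerm_add_right]

theorem qmul_zero_left (δ : Derivation ℂ R R) (q : LaurentSeries R) : qmul δ 0 q = 0 := by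
  have := qmul_add_left δ 0 0 q
  simpa using this

theorem qmul_zero_right (δ : Derivation ℂ R R) (p : LaurentSeries R) : qmul δ p 0 = 0 := by
  have := qmul_add_right δ p 0 0
  simpa using this

theorem qmul_single (δ : Derivation ℂ R R) (i : ℤ) (f : R) (q : LaurentSeries R) (n : ℤ) :
    (qmul δ (HahnSeries.single i f) q).coeff n =
      ∑ᶠ k : ℕ, qcoef i k • (f * δ^[k] (q.coeff (n - i - 2 * k))) := by
  refine finsum_congr fun k => ?_
  have h1 : qshift k (HahnSeries.single i f) = HahnSeries.single (i + 2 * k) (qcoef i k • f) := by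
    ext m
    rw [qshift_coeff]
    by_cases h : m = i + 2 * k
    · subst h; simp
    · rw [HahnSeries.coeff_single_of_ne h, HahnSeries.coeff_single_of_ne (by lia), smul_zero]
  have h2 : ∀ (k : ℕ) (m : ℤ), ((coeffDeriv δ)^[k] q).coeff m = δ^[k] (q.coeff m) := by
    intro k m
    induction k with
    | zero => rfl
    | succ k ih => rw [Function.iterate_succ_apply', Function.iterate_succ_apply',
        coeffDeriv_coeff, ih]
  rw [mulTerm, h1, HahnSeries.coeff_single_mul, h2, smul_mul_assoc, sub_sub]

theorem qcoef_zero_left (k : ℕ) : qcoef 0 (k + 1) = 0 := by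
  rw [qcoef, Finset.prod_range_succ']
  simp

/-- Left multiplication by an element of `R` is coefficientwise. -/
theorem qmul_C (δ : Derivation ℂ R R) (f : R) (q : LaurentSeries R) (n : ℤ) :
    (qmul δ (HahnSeries.single 0 f) q).coeff n = f * q.coeff n := by
  rw [qmul_single, finsum_eq_single _ 0]
  · simp [qcoef]
  · rintro (_ | k) hk
    · exact absurd rfl hk
    · rw [qcoef_zero_left, zero_smul]

theorem qmul_one_left (δ : Derivation ℂ R R) (q : LaurentSeries R) :
    qmul δ (HahnSeries.single 0 1) q = q := by
  ext n; rw [qmul_C, one_mul]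

theorem qmul_one_right (δ : Derivation ℂ R R) (p : LaurentSeries R) :
    qmul δ p (HahnSeries.single 0 1) = p := by
  have h : ∀ k : ℕ, (coeffDeriv δ)^[k + 1] (HahnSeries.single 0 (1 : R)) = 0 := by
    intro k
    have h0 : coeffDeriv δ (HahnSeries.single 0 (1 : R)) = 0 := by
      ext n
      rw [coeffDeriv_coeff, HahnSeries.coeff_single]
      split_ifs <;> simp
    rw [Function.iterate_succ_apply, h0]
    exact iterate_map_zero (coeffDeriv δ) k
  ext n
  change ∑ᶠ k : ℕ, _ = _
  rw [finsum_eq_single _ 0]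
  · simp [mulTerm, qshift_zero]
  · rintro (_ | k) hk
    · exact absurd rfl hk
    · rw [mulTerm, h, mul_zero, HahnSeries.coeff_zero]

theorem coeffDeriv_iter_sum {ι : Type*} (δ : Derivation ℂ R R) (k : ℕ) (s : Finset ι)
    (f : ι → LaurentSeries R) :
    (coeffDeriv δ)^[k] (∑ i ∈ s, f i) = ∑ i ∈ s, (coeffDeriv δ)^[k] (f i) := by
  induction k with
  | zero => rfl
  | succ k ih => simp only [Function.iterate_succ_apply', ih, map_sum]

theorem sum_range_antidiagonal {M : Type*} [AddCommMonoid M] (K : ℕ) (g : ℕ → ℕ → M)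
    (hg : ∀ u v, K ≤ u + v → g u v = 0) :
    ∑ l ∈ Finset.range K, ∑ uv ∈ Finset.HasAntidiagonal.antidiagonal l, g uv.1 uv.2 =
      ∑ u ∈ Finset.range K, ∑ v ∈ Finset.range K, g u v := by
  rw [Finset.sum_sigma', ← Finset.sum_product']
  refine Finset.sum_of_injOn (fun x => x.2) ?_ ?_ ?_ (fun _ _ => rfl)
  · rintro ⟨l, u, v⟩ h ⟨l', u', v'⟩ h' e
    simp at h h' e
    obtain ⟨rfl, rfl⟩ := e
    obtain ⟨_, rfl⟩ := h
    obtain ⟨_, rfl⟩ := h'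
    rfl
  · rintro ⟨l, u, v⟩ h
    simp at h ⊢
    lia
  · rintro ⟨u, v⟩ _ h
    refine hg u v ?_
    by_contra hlt
    exact h ⟨⟨u + v, u, v⟩, by simp; lia, rfl⟩

theorem qmul_assoc (δ : Derivation ℂ R R) (p q r : LaurentSeries R) :
    qmul δ (qmul δ p q) r = qmul δ p (qmul δ q r) := by
  obtain ⟨a, ha⟩ := exists_ordGE p
  obtain ⟨b, hb⟩ := exists_ordGE q
  obtain ⟨c, hc⟩ := exists_ordGE r
  ext n
  obtain ⟨K, hK⟩ := exists_bound (a + b + c) n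
  -- truncations of the inner products
  set P := ∑ k ∈ Finset.range K, mulTerm δ k p q with hP
  set Q := ∑ k ∈ Finset.range K, mulTerm δ k q r with hQ
  have hP' : OrdGE (a + b + 2 * K) (qmul δ p q - P) := fun m hm => by
    rw [HahnSeries.coeff_sub, qmul_coeff δ ha hb m K hm, sub_self]
  have hQ' : OrdGE (b + c + 2 * K) (qmul δ q r - Q) := fun m hm => by
    rw [HahnSeries.coeff_sub, qmul_coeff δ hb hc m K hm, sub_self]
  have hPo : OrdGE (a + b) P := ordGE_sum _ _ fun k _ => (ha.mulTerm hb δ k).mono (by lia)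
  have hQo : OrdGE (b + c) Q := ordGE_sum _ _ fun k _ => (hb.mulTerm hc δ k).mono (by lia)
  have e1 : (qmul δ (qmul δ p q) r).coeff n = (qmul δ P r).coeff n := by
    have h := qmul_add_left δ (qmul δ p q - P) P r
    rw [sub_add_cancel] at h
    rw [h, HahnSeries.coeff_add, (hP'.qmul hc δ) n (by lia), zero_add]
  have e2 : (qmul δ p (qmul δ q r)).coeff n = (qmul δ p Q).coeff n := by
    have h := qmul_add_right δ p (qmul δ q r - Q) Q
    rw [sub_add_cancel] at h
    rw [h, HahnSeries.coeff_add, (ha.qmul hQ' δ) n (by lia), zero_add]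
  rw [e1, e2, qmul_coeff δ hPo hc n K (by lia), qmul_coeff δ ha hQo n K (by lia)]
  let T : ℕ → ℕ → ℕ → LaurentSeries R := fun k u v =>
    (k + u).choose u • (qshift (k + u) p *
      qshift v ((coeffDeriv δ)^[k] q) * (coeffDeriv δ)^[u + v] r)
  have hT : ∀ k u v, K ≤ k + u + v → (T k u v).coeff n = 0 := fun k u v h =>
    (((ha.qshift (k + u)).cmul ((hb.deriv δ k).qshift v)).cmul (hc.deriv δ (u + v))).nsmul
      _ n (by push_cast; lia)
  have l1 : ∀ l, mulTerm δ l P r = ∑ k ∈ Finset.range K,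
      ∑ uv ∈ Finset.HasAntidiagonal.antidiagonal l, T k uv.1 uv.2 := by
    intro l
    rw [mulTerm, hP, qshift_sum, Finset.sum_mul]
    refine Finset.sum_congr rfl fun k _ => ?_
    rw [mulTerm, qshift_mul, Finset.sum_mul]
    refine Finset.sum_congr rfl fun uv huv => ?_
    rw [Finset.HasAntidiagonal.mem_antidiagonal] at huv
    simp only [T]
    rw [qshift_qshift, huv, smul_mul_assoc, smul_mul_assoc, add_comm uv.1 k]
  have l2 : ∀ l, mulTerm δ l p Q = ∑ v ∈ Finset.range K,
      ∑ ku ∈ Finset.HasAntidiagonal.antidiagonal l, T ku.1 ku.2 v := by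
    intro l
    rw [mulTerm, hQ, coeffDeriv_iter_sum, Finset.mul_sum]
    refine Finset.sum_congr rfl fun v _ => ?_
    rw [mulTerm, coeffDeriv_iter_mul, Finset.mul_sum]
    refine Finset.sum_congr rfl fun ku hku => ?_
    rw [Finset.HasAntidiagonal.mem_antidiagonal] at hku
    simp only [T]
    rw [coeffDeriv_iter_qshift, ← Function.iterate_add_apply, hku, mul_smul_comm, mul_assoc,
      Nat.choose_symm_of_eq_add hku.symm]
  simp only [l1, l2, HahnSeries.coeff_sum]
  rw [Finset.sum_comm]
  conv_rhs => rw [Finset.sum_comm]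
  have h1 : ∀ k ∈ Finset.range K, ∑ l ∈ Finset.range K,
      ∑ uv ∈ Finset.HasAntidiagonal.antidiagonal l, (T k uv.1 uv.2).coeff n =
      ∑ u ∈ Finset.range K, ∑ v ∈ Finset.range K, (T k u v).coeff n := fun k _ =>
    sum_range_antidiagonal K (fun u v => (T k u v).coeff n) fun u v h => hT k u v (by lia)
  have h2 : ∀ v ∈ Finset.range K, ∑ l ∈ Finset.range K,
      ∑ ku ∈ Finset.HasAntidiagonal.antidiagonal l, (T ku.1 ku.2 v).coeff n =
      ∑ k ∈ Finset.range K, ∑ u ∈ Finset.range K, (T k u v).coeff n := fun v _ =>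
    sum_range_antidiagonal K (fun k u => (T k u v).coeff n) fun k u h => hT k u v (by lia)
  rw [Finset.sum_congr rfl h1, Finset.sum_congr rfl h2]
  conv_rhs => rw [Finset.sum_comm]
  refine Finset.sum_congr rfl fun k _ => ?_
  rw [Finset.sum_comm]

theorem qmul_leading (δ : Derivation ℂ R R) {a b : ℤ} {p q : LaurentSeries R} (hp : OrdGE a p)
    (hq : OrdGE b q) : (qmul δ p q).coeff (a + b) = p.coeff a * q.coeff b := by
  rw [qmul_coeff δ hp hq (a + b) 1 (by simp), Finset.sum_range_one, mulTerm, qshift_zero,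
    Function.iterate_zero, id, HahnSeries.coeff_mul]
  rw [Finset.sum_eq_single (a, b)]
  · rintro ⟨i, j⟩ hij hne
    rw [Finset.mem_antidiagonal] at hij
    simp only at hij
    rcases lt_trichotomy i a with h | h | h
    · rw [hp _ h, zero_mul]
    · exact absurd (Prod.ext h (by simp only; lia)) hne
    · rw [hq _ (by lia), mul_zero]
  · intro h
    rw [Finset.mem_antidiagonal] at h
    by_contra hne
    exact h ⟨fun h0 => hne (by simp only at h0 ⊢; rw [h0, zero_mul]),
      fun h0 => hne (by simp only at h0 ⊢; rw [h0, mul_zero]), rfl⟩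

end Ring
end QuadPDO

open QuadPDO

/-- The ring `C = R((y ; δ))₂` of quadratic formal pseudodifferential operators in `δ`: Laurent
series `∑ fᵢ yⁱ` with coefficients in `R` written on the left, multiplied by the rule
`yⁱ f = ∑ₖ qcoef i k δᵏ(f) y^(i + 2k)` (see `QPDO.y_mul`). -/
def QPDO {R : Type*} [CommRing R] [Algebra ℂ R] (_δ : Derivation ℂ R R) : Type _ :=
  LaurentSeries R

namespace QPDO

variable {R : Type*} [CommRing R] [Algebra ℂ R] {δ : Derivation ℂ R R}

noncomputable instance : AddCommGroup (QPDO δ) := inferInstanceAs (AddCommGroup (LaurentSeries R))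

noncomputable instance : Ring (QPDO δ) where
  mul := qmul δ
  one := HahnSeries.single 0 1
  mul_assoc := qmul_assoc δ
  left_distrib := qmul_add_right δ
  right_distrib := qmul_add_left δ
  zero_mul := qmul_zero_left δ
  mul_zero := qmul_zero_right δ
  one_mul := qmul_one_left δ
  mul_one := qmul_one_right δ
  neg_add_cancel := neg_add_cancel
  zsmul := (· • ·)
  zsmul_zero' := zero_zsmul
  zsmul_succ' := SubNegMonoid.zsmul_succ'
  zsmul_neg' := SubNegMonoid.zsmul_neg'
  sub_eq_add_neg := sub_eq_add_neg

noncomputable instance : Module ℂ (QPDO δ) := inferInstanceAs (Module ℂ (HahnSeries ℤ R))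

/-- The coefficient of `yⁿ`. -/
def coeff (q : QPDO δ) (n : ℤ) : R := HahnSeries.coeff q n

@[ext] theorem ext {p q : QPDO δ} (h : ∀ n, p.coeff n = q.coeff n) : p = q :=
  HahnSeries.ext (funext h)

/-- The monomial `f yⁿ`. -/
noncomputable def mono (δ : Derivation ℂ R R) (n : ℤ) (f : R) : QPDO δ :=
  (HahnSeries.single n f : LaurentSeries R)

/-- The inclusion of `R` in `C`. -/
noncomputable abbrev C (δ : Derivation ℂ R R) (f : R) : QPDO δ := mono δ 0 f

/-- The generator `y` of `C`. -/
noncomputable abbrev y (δ : Derivation ℂ R R) : QPDO δ := mono δ 1 1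

theorem mono_coeff (i : ℤ) (f : R) (n : ℤ) : (mono δ i f).coeff n = if n = i then f else 0 := by
  refine HahnSeries.coeff_single.trans ?_
  split_ifs <;> rfl

theorem mono_mul_coeff (i : ℤ) (f : R) (q : QPDO δ) (n : ℤ) : (mono δ i f * q).coeff n =
    ∑ᶠ k : ℕ, qcoef i k • (f * δ^[k] (q.coeff (n - i - 2 * k))) := qmul_single δ i f q n

theorem C_mul_coeff (f : R) (q : QPDO δ) (n : ℤ) : (C δ f * q).coeff n = f * q.coeff n :=
  qmul_C δ f q n

theorem mono_mul_mono_one (i j : ℤ) (f : R) : mono δ i f * mono δ j 1 = mono δ (i + j) f := by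
  ext n
  rw [mono_mul_coeff, finsum_eq_single _ 0]
  · simp only [Nat.cast_zero, mul_zero, sub_zero, Function.iterate_zero, id, mono_coeff]
    by_cases h : n = i + j
    · rw [if_pos (by lia), if_pos h]; simp [qcoef]
    · rw [if_neg (by lia), if_neg h]; simp
  · rintro (_ | k) hk
    · exact absurd rfl hk
    · rw [mono_coeff, Function.iterate_succ_apply]
      have : δ (if n - i - 2 * ((k + 1 : ℕ) : ℤ) = j then (1 : R) else 0) = 0 := by
        split_ifs <;> simp
      rw [this, iterate_map_zero, mul_zero, smul_zero]

theorem C_mul_C (f g : R) : C δ f * C δ g = C δ (f * g) := by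
  ext n
  rw [C_mul_coeff, mono_coeff, mono_coeff]
  split_ifs <;> simp

theorem C_one : C δ 1 = 1 := rfl

/-- The submodule `C_a` of the series of valuation at least `a`. -/
def ValGE (a : ℤ) (q : QPDO δ) : Prop := ∀ n < a, q.coeff n = 0

theorem ValGE.mul {a b : ℤ} {p q : QPDO δ} (hp : ValGE a p) (hq : ValGE b q) :
    ValGE (a + b) (p * q) := OrdGE.qmul hp hq δ

theorem ValGE.add {a : ℤ} {p q : QPDO δ} (hp : ValGE a p) (hq : ValGE a q) :
    ValGE a (p + q) := OrdGE.add hp hq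

theorem ValGE.sub {a : ℤ} {p q : QPDO δ} (hp : ValGE a p) (hq : ValGE a q) :
    ValGE a (p - q) := OrdGE.sub hp hq

theorem ValGE.of_le {a b : ℤ} {p : QPDO δ} (hp : ValGE b p) (h : a ≤ b) : ValGE a p :=
  OrdGE.mono hp h

theorem coeff_add (p q : QPDO δ) (n : ℤ) : (p + q).coeff n = p.coeff n + q.coeff n := rfl

theorem coeff_sub (p q : QPDO δ) (n : ℤ) : (p - q).coeff n = p.coeff n - q.coeff n :=
  HahnSeries.coeff_sub ..

theorem leading_mul {a b : ℤ} {p q : QPDO δ} (hp : ValGE a p) (hq : ValGE b q) :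
    (p * q).coeff (a + b) = p.coeff a * q.coeff b := qmul_leading δ hp hq

theorem valGE_mono (n : ℤ) (f : R) : ValGE n (mono δ n f) := fun m hm => by
  rw [mono_coeff, if_neg hm.ne]

theorem exists_valGE (q : QPDO δ) : ∃ a, ValGE a q := exists_ordGE (R := R) q

/-- A series with coefficients `c` supported in `[a, ∞)`. -/
noncomputable def ofCoeff (δ : Derivation ℂ R R) (a : ℤ) (c : ℤ → R) (hc : ∀ n < a, c n = 0) :
    QPDO δ :=
  (HahnSeries.ofSuppBddBelow c ⟨a, fun n hn => by
    by_contra hlt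
    exact hn (hc n (by lia))⟩ : LaurentSeries R)

theorem ofCoeff_coeff (a : ℤ) (c : ℤ → R) (hc : ∀ n < a, c n = 0) (n : ℤ) :
    (ofCoeff δ a c hc).coeff n = c n := rfl

/-- The series `∑ₙ aₙ y^(m + 2n)`. -/
noncomputable def series (δ : Derivation ℂ R R) (m : ℤ) (a : ℕ → R) : QPDO δ :=
  ofCoeff δ m (fun N => if m ≤ N ∧ 2 ∣ N - m then a ((N - m) / 2).toNat else 0)
    fun N hN => if_neg fun h => absurd h.1 (by lia)

theorem series_coeff (m : ℤ) (a : ℕ → R) (n : ℕ) :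
    (series δ m a).coeff (m + 2 * n) = a n := by
  refine (if_pos ⟨by lia, by simp⟩).trans ?_
  congr 1
  lia

theorem series_coeff_eq_zero (m : ℤ) (a : ℕ → R) (N : ℤ) (hN : ∀ n : ℕ, N ≠ m + 2 * n) :
    (series δ m a).coeff N = 0 := by
  refine if_neg ?_
  rintro ⟨h, c, hc⟩
  exact hN c.toNat (by lia)

/-- The commutation rule of `C`. -/
theorem y_mul (i : ℤ) (f : R) :
    mono δ i 1 * C δ f = series δ i (fun k => qcoef i k • δ^[k] f) := by
  ext m
  rw [mono_mul_coeff]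
  have ht : ∀ k : ℕ, qcoef i k • ((1 : R) * δ^[k] ((C δ f).coeff (m - i - 2 * k))) =
      if m = i + 2 * k then qcoef i k • δ^[k] f else 0 := by
    intro k
    rw [mono_coeff, one_mul]
    by_cases h : m = i + 2 * k
    · rw [if_pos (by lia), if_pos h]
    · rw [if_neg (by lia), if_neg h, iterate_map_zero, smul_zero]
  simp only [ht]
  by_cases h : ∃ n : ℕ, m = i + 2 * n
  · obtain ⟨n, rfl⟩ := h
    rw [series_coeff, finsum_eq_single _ n fun k hk => if_neg (by lia), if_pos rfl]
  · push Not at h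
    rw [series_coeff_eq_zero _ _ _ h]
    simp [h]

theorem sqrt_unique {e : Rˣ} {z z' : QPDO δ} (hz : ValGE 1 z) (hz' : ValGE 1 z')
    (h1 : z.coeff 1 = e) (h1' : z'.coeff 1 = e) (h : z * z = z' * z') : z = z' := by
  have key : ∀ m : ℕ, ValGE (1 + m : ℤ) (z - z') := by
    intro m
    induction m with
    | zero => simpa using hz.sub hz'
    | succ m ih =>
      intro n hn
      rcases lt_or_ge n (1 + m) with hlt | hge
      · exact ih n hlt
      obtain rfl : n = 1 + m := by lia
      have h0 : (z - z') * z + z' * (z - z') = 0 := by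
        rw [sub_mul, mul_sub, h]; abel
      have hc := congrArg (fun q : QPDO δ => q.coeff (1 + m + 1)) h0
      simp only [coeff_add] at hc
      rw [leading_mul ih hz, show (1 + m + 1 : ℤ) = 1 + (1 + m) by ring, leading_mul hz' ih,
        h1, h1', mul_comm, ← two_mul] at hc
      change _ = (0 : R) at hc
      have h2 : IsUnit (2 : R) := by
        have : (2 : R) = algebraMap ℂ R 2 := (map_ofNat (algebraMap ℂ R) 2).symm
        rw [this]
        exact (IsUnit.mk0 (2 : ℂ) two_ne_zero).map _
      exact (e.isUnit.mul_right_eq_zero).1 ((h2.mul_right_eq_zero).1 hc)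
  rw [← sub_eq_zero]
  ext n
  exact key n.toNat n (by lia)

theorem exists_sqrt (e : Rˣ) (q : QPDO δ) (hq : ValGE 2 q) (h2 : q.coeff 2 = (e : R) * e) :
    ∃ z : QPDO δ, ValGE 1 z ∧ z.coeff 1 = e ∧ z * z = q := by
  obtain ⟨h, hh⟩ : ∃ h : R, 2 * (e * h) = 1 := by
    refine ⟨algebraMap ℂ R 2⁻¹ * (e⁻¹ : Rˣ), ?_⟩
    have h2 : (2 : R) * algebraMap ℂ R 2⁻¹ = 1 := by
      rw [← map_ofNat (algebraMap ℂ R) 2, ← map_mul]; simp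
    calc (2 : R) * (e * (algebraMap ℂ R 2⁻¹ * (e⁻¹ : Rˣ)))
        = (2 * algebraMap ℂ R 2⁻¹) * (e * (e⁻¹ : Rˣ)) := by ring
      _ = 1 := by rw [h2, Units.mul_inv, one_mul]
  let step : ℕ → QPDO δ → QPDO δ := fun n z =>
    z + mono δ (n + 2) (h * (q - z * z).coeff (n + 3))
  let zs : ℕ → QPDO δ := fun n => Nat.rec (mono δ 1 (e : R)) step n
  have hs : ∀ n, zs (n + 1) = zs n + mono δ (n + 2) (h * (q - zs n * zs n).coeff (n + 3)) :=
    fun n => rfl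
  have inv : ∀ n : ℕ, ValGE 1 (zs n) ∧ (zs n).coeff 1 = e ∧
      ValGE (n + 3 : ℤ) (q - zs n * zs n) := by
    intro n
    induction n with
    | zero =>
      refine ⟨valGE_mono _ _, by change (mono δ 1 (e : R)).coeff 1 = e; simp [mono_coeff], ?_⟩
      intro m hm
      have hz : ValGE 1 (mono δ 1 (e : R)) := valGE_mono _ _
      change (q - mono δ 1 (e : R) * mono δ 1 (e : R)).coeff m = 0
      rw [coeff_sub]
      rcases lt_or_ge m 2 with hlt | hge
      · rw [hq m hlt, (hz.mul hz) m (by lia), sub_zero]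
      · obtain rfl : m = 1 + 1 := by lia
        rw [leading_mul hz hz, mono_coeff, if_pos rfl, ← h2]
        exact sub_self _
    | succ n ih =>
      obtain ⟨i1, i2, i3⟩ := ih
      set t := h * (q - zs n * zs n).coeff (n + 3) with ht
      have hw : ValGE (n + 2 : ℤ) (mono δ (n + 2) t) := valGE_mono _ _
      refine ⟨?_, ?_, ?_⟩
      · rw [hs]; exact i1.add (hw.of_le (by lia))
      · rw [hs, coeff_add, i2, hw 1 (by lia), add_zero]
      · intro m hm
        have ex : q - zs (n + 1) * zs (n + 1) = (q - zs n * zs n) - zs n * mono δ (n + 2) t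
            - mono δ (n + 2) t * zs n - mono δ (n + 2) t * mono δ (n + 2) t := by
          rw [hs]; simp only [← ht, add_mul, mul_add]; abel
        rw [ex, coeff_sub, coeff_sub, coeff_sub, (hw.mul hw) m (by lia), sub_zero]
        rcases lt_or_ge m (n + 3) with hlt | hge
        · rw [i3 m hlt, (i1.mul hw) m (by lia), (hw.mul i1) m (by lia)]; simp
        · obtain rfl : m = n + 3 := by lia
          have a1 : (zs n * mono δ (n + 2) t).coeff (n + 3) = e * t := by
            rw [show (n + 3 : ℤ) = 1 + (n + 2) by ring, leading_mul i1 hw, i2, mono_coeff,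
              if_pos rfl]
          have a2 : (mono δ (n + 2) t * zs n).coeff (n + 3) = t * e := by
            rw [show (n + 3 : ℤ) = (n + 2) + 1 by ring, leading_mul hw i1, i2, mono_coeff,
              if_pos rfl]
          rw [a1, a2, ht]
          linear_combination (-(q - zs n * zs n).coeff (n + 3)) * hh
  have stab1 : ∀ (n : ℕ) (j : ℤ), j < n + 2 → (zs (n + 1)).coeff j = (zs n).coeff j := by
    intro n j hj
    rw [hs, coeff_add, valGE_mono _ _ j hj, add_zero]
  have stab : ∀ (n m : ℕ) (j : ℤ), j < n + 2 → n ≤ m → (zs m).coeff j = (zs n).coeff j := by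
    intro n m j hj hnm
    induction m, hnm using Nat.le_induction with
    | base => rfl
    | succ m hm ih => rw [stab1 m j (by lia), ih]
  let z : QPDO δ := ofCoeff δ 1 (fun j => (zs j.toNat).coeff j) fun j hj => (inv _).1 j hj
  have hzc : ∀ j, z.coeff j = (zs j.toNat).coeff j := fun j => rfl
  have hz1 : ValGE 1 z := fun j hj => (inv _).1 j hj
  have hzn : ∀ n : ℕ, ValGE (n + 2 : ℤ) (z - zs n) := by
    intro n j hj
    rw [coeff_sub, hzc, sub_eq_zero]
    rcases le_total j.toNat n with hle | hle
    · exact (stab _ _ j (by lia) hle).symm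
    · exact stab _ _ j hj hle
  refine ⟨z, hz1, (inv 1).2.1, ?_⟩
  rw [eq_comm, ← sub_eq_zero]
  ext m
  have hb : ValGE (m.toNat + 3 : ℤ) (q - z * z) := by
    have ex : q - z * z = (q - zs m.toNat * zs m.toNat) - ((z - zs m.toNat) * z +
        zs m.toNat * (z - zs m.toNat)) := by
      rw [sub_mul, mul_sub]; abel
    rw [ex]
    refine (inv _).2.2.sub (ValGE.add ?_ ?_)
    · exact ((hzn _).mul hz1).of_le (by lia)
    · exact ((inv _).1.mul (hzn _)).of_le (by lia)
  exact hb m (by lia)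

theorem y_sq : y δ ^ 2 = mono δ 2 1 := by
  rw [sq, mono_mul_mono_one]; rfl

theorem exists_yImage (δ : Derivation ℂ R R) (s : Rˣ) :
    ∃ z : QPDO δ, ValGE 1 z ∧ z.coeff 1 = ((s⁻¹ : Rˣ) : R) ∧
      z * z = y δ ^ 2 * C δ ((s ^ (-2 : ℤ) : Rˣ) : R) := by
  refine exists_sqrt s⁻¹ _ ?_ ?_
  · rw [y_sq]; exact ((valGE_mono 2 1).mul (valGE_mono 0 _)).of_le (by simp)
  · have h := leading_mul (valGE_mono (δ := δ) 2 1) (valGE_mono (δ := δ) 0 ((s ^ (-2 : ℤ) : Rˣ) : R))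
    rw [add_zero, mono_coeff, mono_coeff, if_pos rfl, if_pos rfl, one_mul] at h
    rw [y_sq, h, ← Units.val_mul]
    congr 1
    group

/-- The image of `y` under the automorphism attached to the unit `s`: the unique square root
of `x s⁻²`, where `x = y²`, whose term of minimal valuation is `s⁻¹ y`. -/
noncomputable def yImage (δ : Derivation ℂ R R) (s : Rˣ) : QPDO δ :=
  (exists_yImage δ s).choose

theorem yImage_spec (δ : Derivation ℂ R R) (s : Rˣ) :
    ValGE 1 (yImage δ s) ∧ (yImage δ s).coeff 1 = ((s⁻¹ : Rˣ) : R) ∧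
      yImage δ s * yImage δ s = y δ ^ 2 * C δ ((s ^ (-2 : ℤ) : Rˣ) : R) :=
  (exists_yImage δ s).choose_spec

/-- `yImage δ s` as an invertible element of `C`. -/
noncomputable def yUnit (δ : Derivation ℂ R R) (s : Rˣ) : (QPDO δ)ˣ :=
  have h1 : (C δ ((s ^ 2 : Rˣ) : R) * mono δ (-2) 1) * (yImage δ s * yImage δ s) = 1 := by
    rw [(yImage_spec δ s).2.2, y_sq, mul_assoc, ← mul_assoc (mono δ (-2) 1), mono_mul_mono_one]
    rw [show mono δ (-2 + 2) (1 : R) = 1 from rfl, one_mul, C_mul_C, ← Units.val_mul]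
    rw [show s ^ 2 * s ^ (-2 : ℤ) = 1 by group]
    rfl
  have h2 : (yImage δ s * yImage δ s) * (C δ ((s ^ 2 : Rˣ) : R) * mono δ (-2) 1) = 1 := by
    rw [(yImage_spec δ s).2.2, y_sq, mul_assoc, ← mul_assoc (C δ _), C_mul_C, ← Units.val_mul]
    rw [show s ^ (-2 : ℤ) * s ^ 2 = 1 by group, Units.val_one, C_one, one_mul, mono_mul_mono_one]
    rfl
  { val := yImage δ s
    inv := (C δ ((s ^ 2 : Rˣ) : R) * mono δ (-2) 1) * yImage δ s
    inv_val := by rw [mul_assoc, h1]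
    val_inv := by
      set u := C δ ((s ^ 2 : Rˣ) : R) * mono δ (-2) 1
      set z := yImage δ s
      have hc : z * u = u * z := by
        calc z * u = (u * (z * z)) * (z * u) := by rw [h1, one_mul]
          _ = u * z * ((z * z) * u) := by simp only [mul_assoc]
          _ = u * z := by rw [h2, mul_one]
      rw [← hc, ← mul_assoc, h2] }

theorem yUnit_val (s : Rˣ) : (yUnit δ s : QPDO δ) = yImage δ s := rfl

theorem valGE_one : ValGE 0 (1 : QPDO δ) := valGE_mono 0 1

theorem valGE_yUnit_zpow (s : Rˣ) (n : ℤ) : ValGE n ((yUnit δ s ^ n : (QPDO δ)ˣ) : QPDO δ) := by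
  have hpos : ValGE 1 (yUnit δ s : QPDO δ) := (yImage_spec δ s).1
  have hneg : ValGE (-1) (((yUnit δ s)⁻¹ : (QPDO δ)ˣ) : QPDO δ) :=
    (((valGE_mono 0 ((s ^ 2 : Rˣ) : R)).mul (valGE_mono (-2) 1)).mul hpos).of_le (by simp)
  induction n using Int.induction_on with
  | zero => simpa using valGE_one
  | succ i ih => rw [zpow_add_one, Units.val_mul]; exact ih.mul hpos
  | pred i ih => rw [zpow_sub_one, Units.val_mul]; exact (ih.mul hneg).of_le (by lia)

/-- The extension to `C` of the ring endomorphism `g` of `R`, with `y ↦ yImage δ s`: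
`∑ fₙ yⁿ ↦ ∑ g(fₙ) (yImage δ s)ⁿ`, summed coefficientwise. -/
noncomputable def extAct (g : R →+* R) (s : Rˣ) (q : QPDO δ) : QPDO δ :=
  ofCoeff δ (exists_valGE q).choose
    (fun N => ∑ᶠ n : ℤ, (C δ (g (q.coeff n)) * ((yUnit δ s ^ n : (QPDO δ)ˣ) : QPDO δ)).coeff N) (by
      intro N hN
      have : ∀ n : ℤ,
          (C δ (g (q.coeff n)) * ((yUnit δ s ^ n : (QPDO δ)ˣ) : QPDO δ)).coeff N = 0 := by
        intro n
        rw [C_mul_coeff]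
        rcases lt_or_ge n (exists_valGE q).choose with h | h
        · rw [(exists_valGE q).choose_spec n h, map_zero, zero_mul]
        · rw [valGE_yUnit_zpow s n N (by lia), mul_zero]
      simp [this])

theorem extAct_coeff (g : R →+* R) (s : Rˣ) (q : QPDO δ) (N : ℤ) :
    (extAct g s q).coeff N =
      ∑ᶠ n : ℤ, g (q.coeff n) * ((yUnit δ s ^ n : (QPDO δ)ˣ) : QPDO δ).coeff N :=
  finsum_congr fun _ => C_mul_coeff _ _ N

/-- The sum defining `extAct` is finite. -/
theorem extAct_finite (g : R →+* R) (s : Rˣ) (q : QPDO δ) (N : ℤ) :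
    (Function.support fun n : ℤ =>
      g (q.coeff n) * ((yUnit δ s ^ n : (QPDO δ)ˣ) : QPDO δ).coeff N).Finite := by
  obtain ⟨a, ha⟩ := exists_valGE q
  refine (Set.finite_Icc a N).subset fun n hn => ⟨?_, ?_⟩
  · by_contra h
    exact hn (by simp only; rw [ha n (by lia), map_zero, zero_mul])
  · by_contra h
    exact hn (by simp only; rw [valGE_yUnit_zpow s n N (by lia), mul_zero])

end QPDO

/-- The filter on `ℂ` of the sets containing a dense open subset of `Ω`. -/
def genericFilter (Ω : TopologicalSpace.Opens ℂ) : Filter ℂ where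
  sets := {S | ∃ U : Set ℂ, IsOpen U ∧ U ⊆ Ω ∧ (Ω : Set ℂ) ⊆ closure U ∧ U ⊆ S}
  univ_sets := ⟨Ω, Ω.isOpen, subset_rfl, subset_closure, Set.subset_univ _⟩
  sets_of_superset := by
    rintro S T ⟨U, hU, h1, h2, h3⟩ hST
    exact ⟨U, hU, h1, h2, h3.trans hST⟩
  inter_sets := by
    rintro S T ⟨U, hU, h1, h2, h3⟩ ⟨V, hV, h1', h2', h3'⟩
    refine ⟨U ∩ V, hU.inter hV, Set.inter_subset_left.trans h1, fun z hz => ?_,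
      Set.inter_subset_inter h3 h3'⟩
    rw [mem_closure_iff]
    intro W hW hzW
    obtain ⟨w, hwW, hwU⟩ := mem_closure_iff.1 (h2 hz) W hW hzW
    obtain ⟨v, ⟨hvW, hvU⟩, hvV⟩ :=
      mem_closure_iff.1 (h2' (h1 hwU)) (W ∩ U) (hW.inter hU) ⟨hwW, hwU⟩
    exact ⟨v, hvW, hvU, hvV⟩

/-- Functions of one complex variable defined on a dense open subset of `Ω`, two functions being
identified when they agree on a dense open subset of `Ω`. -/
abbrev GenFun (Ω : TopologicalSpace.Opens ℂ) : Type := (genericFilter Ω).Germ ℂ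

namespace GenFun

variable {Ω : TopologicalSpace.Opens ℂ}

noncomputable instance : Algebra ℂ (GenFun Ω) :=
  Algebra.ofModule
    (fun c f g => by
      induction f using Filter.Germ.inductionOn with | _ f
      induction g using Filter.Germ.inductionOn with | _ g
      exact congrArg _ (smul_mul_assoc c f g))
    (fun c f g => by
      induction f using Filter.Germ.inductionOn with | _ f
      induction g using Filter.Germ.inductionOn with | _ g
      exact congrArg _ (mul_smul_comm c f g))

theorem eventually_iff_open {P : ℂ → Prop} (h : ∀ᶠ z in genericFilter Ω, P z) :
    ∀ᶠ z in genericFilter Ω, ∀ᶠ w in nhds z, P w := by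
  obtain ⟨U, hU, h1, h2, h3⟩ := h
  exact ⟨U, hU, h1, h2, fun z hz => Filter.mem_of_superset (hU.mem_nhds hz) h3⟩

/-- The derivation `∂_z`. -/
noncomputable def deriv : GenFun Ω → GenFun Ω :=
  Filter.Germ.map' _root_.deriv fun f g hfg => by
    filter_upwards [eventually_iff_open hfg] with z hz
    exact Filter.EventuallyEq.deriv_eq hz

/-- Holomorphic on a dense open subset of `Ω`. -/
def IsHolomorphic (f : GenFun Ω) : Prop :=
  ∃ F : ℂ → ℂ, f = (F : GenFun Ω) ∧ ∀ᶠ z in genericFilter Ω, DifferentiableAt ℂ F z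

theorem deriv_coe (F : ℂ → ℂ) : deriv (F : GenFun Ω) = (_root_.deriv F : ℂ → ℂ) := rfl

theorem deriv_add {f g : GenFun Ω} (hf : IsHolomorphic f) (hg : IsHolomorphic g) :
    deriv (f + g) = deriv f + deriv g := by
  obtain ⟨F, rfl, hF⟩ := hf
  obtain ⟨G, rfl, hG⟩ := hg
  refine Filter.Germ.coe_eq.2 ?_
  filter_upwards [hF, hG] with z h1 h2
  exact _root_.deriv_add h1 h2

theorem deriv_mul {f g : GenFun Ω} (hf : IsHolomorphic f) (hg : IsHolomorphic g) :
    deriv (f * g) = f * deriv g + g * deriv f := by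
  obtain ⟨F, rfl, hF⟩ := hf
  obtain ⟨G, rfl, hG⟩ := hg
  refine Filter.Germ.coe_eq.2 ?_
  filter_upwards [hF, hG] with z h1 h2
  change _root_.deriv (F * G) z = F z * _root_.deriv G z + G z * _root_.deriv F z
  rw [_root_.deriv_mul h1 h2]
  ring

theorem deriv_smul (c : ℂ) (f : GenFun Ω) : deriv (c • f) = c • deriv f := by
  induction f using Filter.Germ.inductionOn with | _ F
  refine Filter.Germ.coe_eq.2 (Filter.Eventually.of_forall fun z => ?_)
  exact deriv_const_smul_field c F

/-- The denominator `cz + d` -/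
def denom (γ : Matrix.SpecialLinearGroup (Fin 2) ℂ) (z : ℂ) : ℂ := γ 1 0 * z + γ 1 1

/-- The homography `z ↦ (az + b)/(cz + d)`. -/
noncomputable def homography (γ : Matrix.SpecialLinearGroup (Fin 2) ℂ) (z : ℂ) : ℂ :=
  (γ 0 0 * z + γ 0 1) / denom γ z

theorem det_eq (γ : Matrix.SpecialLinearGroup (Fin 2) ℂ) : γ 0 0 * γ 1 1 - γ 0 1 * γ 1 0 = 1 := by
  have := γ.det_coe
  rwa [Matrix.det_fin_two] at this

theorem continuous_denom (γ : Matrix.SpecialLinearGroup (Fin 2) ℂ) : Continuous (denom γ) := by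
  unfold denom; fun_prop

theorem continuousAt_homography {γ : Matrix.SpecialLinearGroup (Fin 2) ℂ} {z : ℂ}
    (hz : denom γ z ≠ 0) : ContinuousAt (homography γ) z :=
  ContinuousAt.div (by fun_prop) (continuous_denom γ).continuousAt hz

theorem denom_inv_homography {γ : Matrix.SpecialLinearGroup (Fin 2) ℂ} {z : ℂ}
    (hz : denom γ z ≠ 0) : denom γ⁻¹ (homography γ z) * denom γ z = 1 := by
  have := det_eq γ
  simp only [homography, denom, Matrix.SpecialLinearGroup.coe_inv, Matrix.adjugate_fin_two] at hz ⊢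
  simp
  field_simp
  linear_combination this

theorem inv_homography {γ : Matrix.SpecialLinearGroup (Fin 2) ℂ} {z : ℂ}
    (hz : denom γ z ≠ 0) : homography γ⁻¹ (homography γ z) = z := by
  have h1 := denom_inv_homography hz
  have h2 : denom γ⁻¹ (homography γ z) ≠ 0 := left_ne_zero_of_mul_eq_one h1
  rw [homography, div_eq_iff h2]
  have := det_eq γ
  have h3 : denom γ⁻¹ (homography γ z) = 1 / denom γ z := by rw [eq_div_iff hz, h1]
  rw [h3]
  simp only [homography, Matrix.SpecialLinearGroup.coe_inv, Matrix.adjugate_fin_two] at hz ⊢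
  simp
  field_simp
  simp only [denom]
  linear_combination z * this

theorem dense_denom (γ : Matrix.SpecialLinearGroup (Fin 2) ℂ) : Dense {z | denom γ z ≠ 0} := by
  have hfin : ({z | denom γ z = 0} : Set ℂ).Subsingleton := by
    intro z hz w hw
    simp only [Set.mem_ofPred_eq, denom] at hz hw
    by_cases hc : γ 1 0 = 0
    · have := det_eq γ
      rw [hc, zero_mul, zero_add] at hz
      rw [hc, hz] at this
      simp at this
    · exact mul_left_cancel₀ hc (by linear_combination hz - hw)
  exact hfin.finite.countable.dense_compl ℝ

theorem eventually_denom_ne_zero (γ : Matrix.SpecialLinearGroup (Fin 2) ℂ) :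
    ∀ᶠ z in genericFilter Ω, denom γ z ≠ 0 := by
  have ho : IsOpen {z | denom γ z ≠ 0} := isOpen_ne.preimage (continuous_denom γ)
  refine ⟨(Ω : Set ℂ) ∩ {z | denom γ z ≠ 0}, Ω.isOpen.inter ho, Set.inter_subset_left, ?_,
    Set.inter_subset_right⟩
  exact (dense_denom γ).open_subset_closure_inter Ω.isOpen

theorem tendsto_homography {γ : Matrix.SpecialLinearGroup (Fin 2) ℂ}
    (h : ∀ z ∈ Ω, denom γ z ≠ 0 → homography γ z ∈ Ω) :
    Filter.Tendsto (homography γ) (genericFilter Ω) (genericFilter Ω) := by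
  rintro S ⟨U, hU, h1, h2, h3⟩
  have ho : IsOpen {z | denom γ z ≠ 0} := isOpen_ne.preimage (continuous_denom γ)
  have hc : ContinuousOn (homography γ) ((Ω : Set ℂ) ∩ {z | denom γ z ≠ 0}) := fun z hz =>
    (continuousAt_homography hz.2).continuousWithinAt
  refine ⟨((Ω : Set ℂ) ∩ {z | denom γ z ≠ 0}) ∩ homography γ ⁻¹' U,
    hc.isOpen_inter_preimage (Ω.isOpen.inter ho) hU, fun z hz => hz.1.1, ?_, fun z hz => h3 hz.2⟩
  intro z hz
  rw [mem_closure_iff]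
  intro W hW hzW
  obtain ⟨z1, ⟨hz1W, hz1Ω⟩, hz1⟩ := (dense_denom γ).inter_open_nonempty (W ∩ Ω)
    (hW.inter Ω.isOpen) ⟨z, hzW, hz⟩ 
  have hz1' : denom γ z1 ≠ 0 := hz1
  have hd : denom γ⁻¹ (homography γ z1) ≠ 0 :=
    left_ne_zero_of_mul_eq_one (denom_inv_homography hz1')
  have hcont := continuousAt_homography hd
  have hN : ∀ᶠ w in nhds (homography γ z1), denom γ⁻¹ w ≠ 0 ∧ homography γ⁻¹ w ∈ W ∩ Ω := by
    refine ((continuous_denom γ⁻¹).continuousAt.eventually_ne hd).and ?_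
    refine hcont.eventually_mem ((hW.inter Ω.isOpen).mem_nhds ?_)
    rw [inv_homography hz1']
    exact ⟨hz1W, hz1Ω⟩
  obtain ⟨V, hV, hVo, hzV⟩ := mem_nhds_iff.1 hN
  obtain ⟨w, hwV, hwU⟩ := mem_closure_iff.1 (h2 (h z1 hz1Ω hz1')) V hVo hzV
  obtain ⟨hw1, hw2, hw3⟩ := hV hwV
  have e1 := denom_inv_homography hw1
  have e2 := inv_homography hw1
  rw [inv_inv] at e1 e2
  refine ⟨homography γ⁻¹ w, hw2, ⟨hw3, left_ne_zero_of_mul_eq_one e1⟩, ?_⟩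
  simpa only [Set.mem_preimage, e2] using hwU

/-- The function `z ↦ f((az + b)/(cz + d))`. -/
noncomputable def pullback (γ : Matrix.SpecialLinearGroup (Fin 2) ℂ)
    (h : ∀ z ∈ Ω, denom γ z ≠ 0 → homography γ z ∈ Ω) (f : GenFun Ω) : GenFun Ω :=
  f.compTendsto (homography γ) (tendsto_homography h)

theorem pullback_add (γ : Matrix.SpecialLinearGroup (Fin 2) ℂ)
    (h : ∀ z ∈ Ω, denom γ z ≠ 0 → homography γ z ∈ Ω) (f g : GenFun Ω) :
    pullback γ h (f + g) = pullback γ h f + pullback γ h g := by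
  induction f using Filter.Germ.inductionOn with | _ F
  induction g using Filter.Germ.inductionOn with | _ G
  rfl

theorem pullback_mul (γ : Matrix.SpecialLinearGroup (Fin 2) ℂ)
    (h : ∀ z ∈ Ω, denom γ z ≠ 0 → homography γ z ∈ Ω) (f g : GenFun Ω) :
    pullback γ h (f * g) = pullback γ h f * pullback γ h g := by
  induction f using Filter.Germ.inductionOn with | _ F
  induction g using Filter.Germ.inductionOn with | _ G
  rfl

end GenFun

/-- A commutative `ℂ`-algebra `R` of functions of one complex variable `z`, which is a domain, on
which the subgroup `Γ` of `SL(2, ℂ)` acts by homographies, which contains all the functions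
`cz + d` and `1 / (cz + d)` attached to elements of `Γ`, and which is stable under `∂_z`.
Its elements are holomorphic functions on dense open subsets of an open set `Ω` stable under the
homographies of `Γ` (`Ω = ℂ` for `ℂ(z)`; `Ω` the upper half-plane for algebras of holomorphic or
meromorphic functions on it). -/
structure HomographicAlgebra (Γ : Subgroup (Matrix.SpecialLinearGroup (Fin 2) ℂ)) where
  Ω : TopologicalSpace.Opens ℂ
  stable : ∀ γ ∈ Γ, ∀ z ∈ Ω, GenFun.denom γ z ≠ 0 → GenFun.homography γ z ∈ Ω
  R : Subalgebra ℂ (GenFun Ω)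
  isDomain : IsDomain R
  isHolomorphic : ∀ f ∈ R, GenFun.IsHolomorphic f
  pullback_mem : ∀ (γ) (hγ : γ ∈ Γ), ∀ f ∈ R, GenFun.pullback γ (stable γ hγ) f ∈ R
  denom_mem : ∀ γ ∈ Γ, (GenFun.denom γ : GenFun Ω) ∈ R
  denom_inv_mem : ∀ γ ∈ Γ, ((fun z => (GenFun.denom γ z)⁻¹ : ℂ → ℂ) : GenFun Ω) ∈ R
  deriv_mem : ∀ f ∈ R, GenFun.deriv f ∈ R

namespace HomographicAlgebra

variable {Γ : Subgroup (Matrix.SpecialLinearGroup (Fin 2) ℂ)} (A : HomographicAlgebra Γ)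

/-- The derivation `∂_z` of `R`. -/
noncomputable def D : Derivation ℂ A.R A.R :=
  Derivation.mk'
    { toFun := fun f => ⟨GenFun.deriv f, A.deriv_mem f f.2⟩
      map_add' := fun f g => Subtype.ext
        (GenFun.deriv_add (A.isHolomorphic f f.2) (A.isHolomorphic g g.2))
      map_smul' := fun c f => Subtype.ext (GenFun.deriv_smul c (f : GenFun A.Ω)) }
    fun f g => Subtype.ext (GenFun.deriv_mul (A.isHolomorphic f f.2) (A.isHolomorphic g g.2))

/-- The homographic action `f ↦ f·γ`, where `(f·γ)(z) = f((az + b)/(cz + d))`. -/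
noncomputable def act (γ : Γ) : A.R →+* A.R where
  toFun f := ⟨GenFun.pullback γ (A.stable γ γ.2) f, A.pullback_mem γ γ.2 f f.2⟩
  map_one' := rfl
  map_zero' := rfl
  map_add' f g := Subtype.ext (GenFun.pullback_add γ (A.stable γ γ.2) f g)
  map_mul' f g := Subtype.ext (GenFun.pullback_mul γ (A.stable γ γ.2) f g)

/-- The invertible element `s_γ = cz + d` of `R`. -/
noncomputable def s (γ : Γ) : A.Rˣ :=
  have h : (GenFun.denom γ : GenFun A.Ω) *
      ((fun z => (GenFun.denom γ z)⁻¹ : ℂ → ℂ) : GenFun A.Ω) = 1 := by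
    refine Filter.Germ.coe_eq.2 ?_
    filter_upwards [GenFun.eventually_denom_ne_zero (γ : Matrix.SpecialLinearGroup (Fin 2) ℂ)]
      with z hz
    exact mul_inv_cancel₀ hz
  { val := ⟨GenFun.denom γ, A.denom_mem γ γ.2⟩
    inv := ⟨((fun z => (GenFun.denom γ z)⁻¹ : ℂ → ℂ) : GenFun A.Ω), A.denom_inv_mem γ γ.2⟩
    val_inv := Subtype.ext h
    inv_val := Subtype.ext ((mul_comm _ _).trans h) }

/-- The weight `m` action `(f|ₘγ)(z) = (cz + d)^(-m) f((az + b)/(cz + d))`. -/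
noncomputable def weightAct (m : ℤ) (γ : Γ) (f : A.R) : A.R :=
  ((A.s γ ^ (-m) : A.Rˣ) : A.R) * A.act γ f

/-- The derivation `δ_z = -½ ∂_z`. -/
noncomputable def δ : Derivation ℂ A.R A.R := (-(1 / 2) : ℂ) • A.D

/-- The ring `C = R((y ; δ_z))₂`. -/
abbrev C : Type := QPDO A.δ

/-- The action of `Γ` on `C` extending the homographic action on `R`: `y·γ` is the square root
`(cz + d)⁻¹ y + ⋯` of `x·γ = x (cz + d)⁻²`, where `x = y²`, and
`(∑ fₙ yⁿ)·γ = ∑ (fₙ·γ) (y·γ)ⁿ`. -/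
noncomputable def actC (γ : Γ) (q : A.C) : A.C := QPDO.extAct (A.act γ) (A.s γ) q

/-- Equivariance of a map `ψ : R → C` for the weight `m` action on `R`. -/
def IsEquivariant (m : ℤ) (ψ : A.R →ₗ[ℂ] A.C) : Prop :=
  ∀ (γ : Γ) (f : A.R), ψ (A.weightAct m γ f) = A.actC γ (ψ f)

/-- The linear map `f ↦ ∑ₙ α(n) f⁽ⁿ⁾ y^(m + 2n)`. -/
noncomputable def seriesMap (m : ℤ) (α : ℕ → ℂ) : A.R →ₗ[ℂ] A.C where
  toFun f := QPDO.series A.δ m fun n => α n • A.D^[n] f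
  map_add' f g := by
    ext N
    rw [QPDO.coeff_add]
    by_cases h : ∃ n : ℕ, N = m + 2 * n
    · obtain ⟨n, rfl⟩ := h
      simp only [QPDO.series_coeff, iterate_map_add, smul_add]
    · push Not at h
      simp only [QPDO.series_coeff_eq_zero _ _ _ h, add_zero]
  map_smul' c f := by
    ext N
    have hc : ∀ q : A.C, (c • q).coeff N = c • q.coeff N := fun q => HahnSeries.coeff_smul ..
    rw [RingHom.id_apply, hc]
    by_cases h : ∃ n : ℕ, N = m + 2 * n
    · obtain ⟨n, rfl⟩ := h
      have hD : ∀ n : ℕ, A.D^[n] (c • f) = c • A.D^[n] f := by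
        intro n
        induction n with
        | zero => rfl
        | succ n ih => rw [Function.iterate_succ_apply', ih, Derivation.map_smul,
            ← Function.iterate_succ_apply' (f := A.D)]
      simp only [QPDO.series_coeff, hD]
      rw [smul_comm]
    · push Not at h
      simp only [QPDO.series_coeff_eq_zero _ _ _ h, smul_zero]

/-- `ψ(f) = ∑ₙ α(n) f⁽ⁿ⁾ y^(m + 2n)` for all `f`. -/
def HasForm (m : ℤ) (ψ : A.R →ₗ[ℂ] A.C) (α : ℕ → ℂ) : Prop := ψ = A.seriesMap m α

/-- The coefficient `(-1)ⁿ / (4ⁿ n!) ∏_{i < n} (m + 2i)(m + 2i + 2) / (m + i)`. -/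
noncomputable def splittingCoef (m n : ℕ) : ℂ :=
  (-1) ^ n / (4 ^ n * (n.factorial : ℂ)) *
    ∏ i ∈ Finset.range n, (((m : ℂ) + 2 * i) * ((m : ℂ) + 2 * i + 2) / ((m : ℂ) + i))

/-- The splitting map `ψ_m : R → C` of positive weight `m`:
`ψ_m(f) = ∑ₙ splittingCoef m n f⁽ⁿ⁾ y^(m + 2n)`. -/
noncomputable def splitting (m : ℕ) : A.R →ₗ[ℂ] A.C := A.seriesMap m (splittingCoef m)

/-- The map `f ↦ ψ_(2k+1)(f^(2k))`. -/
noncomputable def derivedSplitting (k : ℕ) : A.R →ₗ[ℂ] A.C :=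
  A.splitting (2 * k + 1) ∘ₗ (A.D : A.R →ₗ[ℂ] A.R) ^ (2 * k)

end HomographicAlgebra

/-! Write `u` for the image of `y`, and `c` for the slope of the affine function `s`. For a map of
the form `∑ α(n) f⁽ⁿ⁾ y^(m + 2n)`, equivariance becomes an identity between two explicit double
arrays once two expansions are known.

The first is that of `uⁱ` (`yUnit_zpow_coeff`). Left multiplication by `y⁻²` has only two terms, and
`u⁻² = s² y⁻²` is a monomial. The commutator with `s y⁻²` preserves degree and has `uⁱ` as an
eigenvector (`lie_mono_neg_two_zpow`). Combined with the fact that `u⁻²` commutes with `uⁱ`, this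
eliminates the derivative of a coefficient and leaves a two-term recursion (`yUnit_zpow_coeff_rec`),
solved by `powerCoef`.

The second is the expansion of `D^M (s^(-m) g(f))` (`iterate_deriv_weight`), with coefficients
`derivCoef`. Equivariance says that `∑ (α(j + l) derivCoef c m j l - α(j) powerCoef c (m + 2j) l)
g(Dʲ f) s^(-m - 2j - l)`, summed over `j + l = M`, vanishes for all `M`
(`seriesMap_weightAct_eq_iff`). For `m > 0` the coefficients `splittingCoef` make every term zero.

For `m = 1 - 2k`, `derivCoef c m j l` contains the factor `m + j + i = 0` as soon as `j < 2k ≤ j +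
l`. This gives Bol's lemma: `D^(2k)` intertwines the weights `1 - 2k` and `1 + 2k`, so
`derivedSplitting` is equivariant. The same vanishing forces uniqueness. Testing on `f = 1` at `M =
2k` gives `α(0) = 0`, because `powerCoef` is nonzero at odd `m`; smaller `M` then gives `α(n) = 0`
for `n < 2k`. Testing on `f = z^(2k)` expresses every later `α(2k + l)` through `α(2k)`. A slope `c
≠ 0` is what makes these factors nonzero and puts a function `z` with `D z = 1` in `R`. -/

namespace QPDO

/-! ### Coefficients of products with monomials -/

section Coefficients

variable {R : Type*} [CommRing R] [Algebra ℂ R] {δ : Derivation ℂ R R}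

theorem coeff_zero (n : ℤ) : (0 : QPDO δ).coeff n = 0 := rfl

theorem coeff_neg (p : QPDO δ) (n : ℤ) : (-p).coeff n = -p.coeff n := rfl

theorem coeffDeriv_iter_single (j : ℤ) (f : R) (k : ℕ) :
    (coeffDeriv δ)^[k] (HahnSeries.single j f) = HahnSeries.single j (δ^[k] f) := by
  induction k with
  | zero => rfl
  | succ k ih =>
    rw [Function.iterate_succ_apply', ih, Function.iterate_succ_apply']
    ext n
    rw [coeffDeriv_coeff, HahnSeries.coeff_single, HahnSeries.coeff_single]
    split_ifs <;> simp

/-- The sum becomes finite as soon as some iterate of `δ` kills `f`; it is applied below to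
constants and to polynomials in `s` of degree at most two. -/
theorem mul_mono_coeff (q : QPDO δ) (j : ℤ) (f : R) (n : ℤ) : (q * mono δ j f).coeff n =
    ∑ᶠ k : ℕ, qcoef (n - j - 2 * k) k • (q.coeff (n - j - 2 * k) * δ^[k] f) := by
  have h : ∀ (p : LaurentSeries R) (k : ℕ), (mulTerm δ k p (HahnSeries.single j f)).coeff n =
      qcoef (n - j - 2 * k) k • (p.coeff (n - j - 2 * k) * δ^[k] f) := fun p k => by
    rw [mulTerm, coeffDeriv_iter_single, HahnSeries.coeff_mul_single, qshift_coeff, smul_mul_assoc]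
  exact finsum_congr (h q)

/-- Constants are central. -/
theorem commute_C {f : R} (hf : δ f = 0) (q : QPDO δ) : C δ f * q = q * C δ f := by
  ext n
  rw [C_mul_coeff, mul_mono_coeff, finsum_eq_single _ 0]
  · simp [qcoef, mul_comm]
  · rintro (_ | k) hk
    · exact absurd rfl hk
    · rw [Function.iterate_succ_apply, hf, iterate_map_zero, mul_zero, smul_zero]

theorem mono_mul_mono (i j : ℤ) (f : R) {g : R} (hg : δ g = 0) :
    mono δ i f * mono δ j g = mono δ (i + j) (f * g) := by
  rw [show mono δ j g = C δ g * mono δ j 1 by rw [mono_mul_mono_one, zero_add],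
    ← mul_assoc, ← commute_C hg, mul_assoc, mono_mul_mono_one]
  ext n
  rw [C_mul_coeff, mono_coeff, mono_coeff]
  split_ifs
  · exact mul_comm _ _
  · simp

theorem qcoef_one (i : ℤ) : qcoef i 1 = i := by simp [qcoef]

theorem qcoef_neg_two (k : ℕ) : qcoef (-2) (k + 2) = 0 := by
  -- The factor of index `1` is `(-2 + 2) / 2`.
  rw [qcoef, Finset.prod_eq_zero (i := 1) (by simp)]
  simp

/-- Since `qcoef (-2) k` vanishes for `k ≥ 2`, `y⁻²` acts as a first-order operator: its commutator
with `f` is `-2 δ(f)`. -/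
theorem mono_neg_two_mul_coeff (f : R) (q : QPDO δ) (n : ℤ) :
    (mono δ (-2) f * q).coeff n = f * (q.coeff (n + 2) - 2 * δ (q.coeff n)) := by
  rw [mono_mul_coeff, finsum_eq_sum_of_support_subset (s := Finset.range 2)]
  · rw [Finset.sum_range_succ, Finset.sum_range_one, qcoef_one, qcoef, Finset.prod_range_zero]
    simp only [Nat.cast_zero, mul_zero, sub_zero, sub_neg_eq_add, Function.iterate_zero, id,
      Nat.cast_one, mul_one, Function.iterate_one, add_sub_cancel_right, one_smul,
      Int.cast_smul_eq_zsmul, zsmul_eq_mul]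
    push_cast
    ring
  · intro k hk
    by_contra h
    obtain ⟨k, rfl⟩ := Nat.exists_eq_add_of_le' (show 2 ≤ k by simpa [Nat.succ_le_iff] using h)
    exact hk (by simp only [qcoef_neg_two, zero_smul])

theorem mul_mono_neg_two_coeff_linear {f : R} (hf : δ (δ f) = 0) (q : QPDO δ) (n : ℤ) :
    (q * mono δ (-2) f).coeff n = q.coeff (n + 2) * f + n * (q.coeff n * δ f) := by
  rw [mul_mono_coeff, finsum_eq_sum_of_support_subset (s := Finset.range 2)]
  · rw [Finset.sum_range_succ, Finset.sum_range_one, qcoef_one, qcoef, Finset.prod_range_zero]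
    simp only [Nat.cast_zero, mul_zero, sub_zero, sub_neg_eq_add, Function.iterate_zero, id,
      Nat.cast_one, mul_one, Function.iterate_one, add_sub_cancel_right, one_smul,
      Int.cast_smul_eq_zsmul, zsmul_eq_mul]
  · intro k hk
    by_contra h
    obtain ⟨k, rfl⟩ := Nat.exists_eq_add_of_le' (show 2 ≤ k by simpa [Nat.succ_le_iff] using h)
    refine hk ?_
    simp only [Function.iterate_succ_apply, hf, iterate_map_zero, mul_zero, smul_zero]

/-- Multiplying by `2` clears the `2!` in `qcoef`, so that all coefficients are integers cast into
`R`. -/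
theorem mul_mono_neg_two_coeff_quadratic {f : R} (hf : δ (δ (δ f)) = 0) (q : QPDO δ) (n : ℤ) :
    2 * (q * mono δ (-2) f).coeff n = 2 * (q.coeff (n + 2) * f) + 2 * (n * (q.coeff n * δ f)) +
      (n - 2) * n * (q.coeff (n - 2) * δ (δ f)) := by
  rw [mul_mono_coeff, finsum_eq_sum_of_support_subset (s := Finset.range 3)]
  · have h2 : (2 : R) * ∑ k ∈ Finset.range 3, qcoef (n - -2 - 2 * k) k •
        (q.coeff (n - -2 - 2 * k) * δ^[k] f) = ∑ k ∈ Finset.range 3,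
        (2 * qcoef (n - -2 - 2 * k) k) • (q.coeff (n - -2 - 2 * k) * δ^[k] f) := by
      rw [Finset.mul_sum]
      refine Finset.sum_congr rfl fun k _ => ?_
      rw [mul_smul, two_smul, two_mul]
    have h3 : 2 * qcoef (n - 2) 2 = (((n - 2) * n : ℤ) : ℂ) := by
      rw [qcoef, Finset.prod_range_succ, Finset.prod_range_one]
      push_cast
      ring
    rw [h2, Finset.sum_range_succ, Finset.sum_range_succ, Finset.sum_range_one, qcoef_one,
      show n - -2 - 2 * ((2 : ℕ) : ℤ) = n - 2 by push_cast; ring, h3, qcoef,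
      Finset.prod_range_zero]
    simp only [Nat.cast_zero, mul_zero, sub_zero, sub_neg_eq_add, Function.iterate_zero, id,
      Nat.cast_one, mul_one, add_sub_cancel_right, mul_smul,
      Int.cast_smul_eq_zsmul, zsmul_eq_mul, Function.iterate_succ_apply, ofNat_smul_eq_nsmul,
      nsmul_eq_mul]
    push_cast
    ring
  · intro k hk
    by_contra h
    obtain ⟨k, rfl⟩ := Nat.exists_eq_add_of_le' (show 3 ≤ k by simpa [Nat.succ_le_iff] using h)
    refine hk ?_
    simp only [Function.iterate_succ_apply, hf, iterate_map_zero, mul_zero, smul_zero]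

theorem isUnit_two : IsUnit (2 : R) := by
  rw [← map_ofNat (algebraMap ℂ R) 2]
  exact (IsUnit.mk0 (2 : ℂ) two_ne_zero).map _

/-- An element with invertible leading coefficient anticommutes only with zero. -/
theorem eq_zero_of_anticommute {e : Rˣ} {z E : QPDO δ} (hz : ValGE 1 z) (h1 : z.coeff 1 = e)
    (h : z * E + E * z = 0) : E = 0 := by
  obtain ⟨a, ha⟩ := exists_valGE E
  have key : ∀ m : ℕ, ValGE (a + m : ℤ) E := by
    intro m
    induction m with
    | zero => simpa using ha
    | succ m ih =>
      intro n hn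
      rcases lt_or_ge n (a + m) with hlt | hge
      · exact ih n hlt
      obtain rfl : n = a + m := by push_cast at hn; lia
      -- If `E` starts at degree `a + m`, the leading term of `zE + Ez` is twice the unit `e` times
      -- that of `E`.
      have hc := congrArg (fun q : QPDO δ => q.coeff (a + m + 1)) h
      simp only [coeff_add] at hc
      rw [leading_mul ih hz, add_comm (a + m : ℤ) 1, leading_mul hz ih, h1, mul_comm,
        ← two_mul] at hc
      exact (e.isUnit.mul_left_eq_zero).1 ((isUnit_two.mul_right_eq_zero).1 hc)
  ext n
  exact key (n - a + 1).toNat n (by lia)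

end Coefficients

/-! ### Commutation relations and recursion for the powers of the image of `y` -/

section YImage

variable {R : Type*} [CommRing R] [Algebra ℂ R] {δ : Derivation ℂ R R}

/-- Although `yImage δ s` is an infinite series in general, its power `-2` is a single monomial; it
commutes with all the powers, which yields a computable relation between their coefficients. -/
theorem yUnit_zpow_neg_two (s : Rˣ) :
    ((yUnit δ s ^ (-2 : ℤ) : (QPDO δ)ˣ) : QPDO δ) = mono δ (-2) ((s ^ 2 : Rˣ) : R) := by
  have h : mono δ (-2) ((s ^ 2 : Rˣ) : R) * (yImage δ s * yImage δ s) = 1 := by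
    rw [show mono δ (-2) ((s ^ 2 : Rˣ) : R) = C δ ((s ^ 2 : Rˣ) : R) * mono δ (-2) 1 by
      rw [mono_mul_mono_one, zero_add], (yImage_spec δ s).2.2, y_sq, mul_assoc,
      ← mul_assoc (mono δ (-2) 1), mono_mul_mono_one]
    rw [show mono δ (-2 + 2) (1 : R) = 1 from rfl, one_mul, C_mul_C, ← Units.val_mul,
      show s ^ 2 * s ^ (-2 : ℤ) = 1 by group]
    rfl
  rw [zpow_neg, ← one_mul ((yUnit δ s ^ (2 : ℤ))⁻¹ : (QPDO δ)ˣ).val, ← h, mul_assoc,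
    show yImage δ s * yImage δ s = ((yUnit δ s ^ (2 : ℤ) : (QPDO δ)ˣ) : QPDO δ) by
      rw [zpow_two, Units.val_mul, yUnit_val], Units.mul_inv, mul_one]

theorem yUnit_zpow_leading (s : Rˣ) (i : ℤ) :
    ((yUnit δ s ^ i : (QPDO δ)ˣ) : QPDO δ).coeff i = ((s ^ (-i) : Rˣ) : R) := by
  have h1 : ((yUnit δ s : QPDO δ)).coeff 1 = ((s⁻¹ : Rˣ) : R) := (yImage_spec δ s).2.1
  have key : ∀ i : ℤ, ((yUnit δ s ^ (i + 1) : (QPDO δ)ˣ) : QPDO δ).coeff (i + 1) =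
      ((yUnit δ s ^ i : (QPDO δ)ˣ) : QPDO δ).coeff i * ((s⁻¹ : Rˣ) : R) := fun i => by
    rw [zpow_add_one, Units.val_mul, ← h1]
    exact leading_mul (valGE_yUnit_zpow s i) (yImage_spec δ s).1
  induction i using Int.induction_on with
  | zero => rw [zpow_zero, neg_zero, zpow_zero]; exact (mono_coeff ..).trans (if_pos rfl)
  | succ i ih => rw [key, ih, ← Units.val_mul, neg_add, ← sub_eq_add_neg, zpow_sub_one]
  | pred i ih =>
    have := key (-i - 1)
    rw [sub_add_cancel, ih] at this
    rw [← Units.mul_left_inj s⁻¹, ← this, ← Units.val_mul]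
    congr 1
    group

variable {s : Rˣ} {e : ℂ}

theorem deriv_sq_units (hs : δ s = algebraMap ℂ R e) :
    δ ((s ^ 2 : Rˣ) : R) = 2 * (algebraMap ℂ R e * s) := by
  rw [Units.val_pow_eq_pow_val, sq, Derivation.leibniz, hs, smul_eq_mul]
  ring

/-- The terms in `q.coeff (n + 2)` cancel because `R` is commutative, and no higher ones occur
because `δ s` is constant. The commutator therefore preserves degree. -/
theorem lie_mono_neg_two_coeff (hs : δ s = algebraMap ℂ R e) (q : QPDO δ) (n : ℤ) :
    (mono δ (-2) (s : R) * q - q * mono δ (-2) (s : R)).coeff n =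
      -(2 * s * δ (q.coeff n)) - n * (q.coeff n * algebraMap ℂ R e) := by
  rw [coeff_sub, mono_neg_two_mul_coeff, mul_mono_neg_two_coeff_linear (by rw [hs]; simp), hs]
  ring

/-- This is the eigenvector relation `[Y, uⁱ] = i K uⁱ` for `Y = s y⁻²` and the central constant `K
= δ s`. It is checked on the monomial `u⁻²`, carried to `u²` by inversion, to `u` by extraction of
the square root, and then to every power. -/
theorem lie_mono_neg_two_zpow (hs : δ s = algebraMap ℂ R e) (i : ℤ) :
    ((yUnit δ s ^ i : (QPDO δ)ˣ) : QPDO δ) *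
        (mono δ (-2) (s : R) + i * C δ (algebraMap ℂ R e)) =
      mono δ (-2) (s : R) * ((yUnit δ s ^ i : (QPDO δ)ˣ) : QPDO δ) := by
  have hK : ∀ q : QPDO δ, C δ (algebraMap ℂ R e) * q = q * C δ (algebraMap ℂ R e) :=
    commute_C (by simp)
  set Y := mono δ (-2) (s : R) with hY
  set K := C δ (algebraMap ℂ R e) with hK'
  have hX : Y * mono δ (-2) ((s ^ 2 : Rˣ) : R) - mono δ (-2) ((s ^ 2 : Rˣ) : R) * Y =
      -(2 * K * mono δ (-2) ((s ^ 2 : Rˣ) : R)) := by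
    ext n
    rw [lie_mono_neg_two_coeff hs, coeff_neg, two_mul K, add_mul, coeff_add, C_mul_coeff,
      mono_coeff]
    split_ifs with h
    · rw [deriv_sq_units hs, h, Units.val_pow_eq_pow_val]
      push_cast
      ring
    · simp
  have h2 : Y * (yImage δ s * yImage δ s) - (yImage δ s * yImage δ s) * Y =
      2 * K * (yImage δ s * yImage δ s) := by
    have hV : yImage δ s * yImage δ s = ((yUnit δ s ^ (2 : ℤ) : (QPDO δ)ˣ) : QPDO δ) := by
      rw [zpow_two, Units.val_mul, yUnit_val]
    have hXV : mono δ (-2) ((s ^ 2 : Rˣ) : R) * (yImage δ s * yImage δ s) = 1 := by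
      rw [hV, ← yUnit_zpow_neg_two, ← Units.val_mul, ← zpow_add]; rfl
    have hVX : (yImage δ s * yImage δ s) * mono δ (-2) ((s ^ 2 : Rˣ) : R) = 1 := by
      rw [hV, ← yUnit_zpow_neg_two, ← Units.val_mul, ← zpow_add]; rfl
    set V := yImage δ s * yImage δ s
    set X := mono δ (-2) ((s ^ 2 : Rˣ) : R)
    calc Y * V - V * Y = (V * X) * Y * V - V * Y * (X * V) := by
          rw [hVX, hXV, one_mul, mul_one]
      _ = -(V * (Y * X - X * Y) * V) := by noncomm_ring
      _ = 2 * (V * K) * (X * V) := by rw [hX]; noncomm_ring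
      _ = 2 * K * V := by rw [hXV, mul_one, ← hK, mul_assoc]
  -- The error `E = [Y, u] - K u` satisfies `u E + E u = [Y, u²] - 2 K u² = 0`, so it vanishes.
  have h1 : Y * yImage δ s - yImage δ s * Y - K * yImage δ s = 0 := by
    refine eq_zero_of_anticommute (yImage_spec δ s).1 (yImage_spec δ s).2.1 ?_
    set u := yImage δ s
    calc u * (Y * u - u * Y - K * u) + (Y * u - u * Y - K * u) * u
        = (Y * (u * u) - (u * u) * Y) - (u * K) * u - K * u * u := by noncomm_ring
      _ = 0 := by rw [h2, ← hK u]; noncomm_ring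
  -- Moving `u` across `Y` costs one `K`, so the integer in front of `K` drops by one for each
  -- factor `u`.
  have hstep : ∀ i : ℤ, (yUnit δ s : QPDO δ) * (Y + ((i + 1 : ℤ) : QPDO δ) * K) =
      (Y + (i : QPDO δ) * K) * (yUnit δ s : QPDO δ) := by
    intro i
    rw [yUnit_val, ← sub_eq_zero]
    set u := yImage δ s
    calc u * (Y + ((i + 1 : ℤ) : QPDO δ) * K) - (Y + (i : QPDO δ) * K) * u
        = -(Y * u - u * Y - u * K) + ((u * (i : QPDO δ)) * K - i * (K * u)) := by
          push_cast; noncomm_ring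
      _ = 0 := by rw [← hK, h1, ← (Int.cast_commute i u).eq, mul_assoc, hK]; noncomm_ring
  induction i using Int.induction_on with
  | zero => simp
  | succ i ih => rw [zpow_add_one, Units.val_mul, mul_assoc, hstep, ← mul_assoc, ih, mul_assoc]
  | pred i ih =>
    have h := hstep (-i - 1)
    rw [sub_add_cancel] at h
    rw [← (yUnit δ s).mul_left_inj, mul_assoc, ← h, ← mul_assoc, ← Units.val_mul, ← zpow_add_one,
      sub_add_cancel, ih, mul_assoc Y, ← Units.val_mul, ← zpow_add_one, sub_add_cancel]

/-- The recursion between the coefficients of `yImage δ s ^ i`. -/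
theorem yUnit_zpow_coeff_rec (hs : δ s = algebraMap ℂ R e) (he : e ≠ 0) (i n : ℤ) :
    ((i - n : ℤ) : R) * (s * ((yUnit δ s ^ i : (QPDO δ)ˣ) : QPDO δ).coeff n) =
      (n * (n - 2) : ℤ) * (algebraMap ℂ R e *
        ((yUnit δ s ^ i : (QPDO δ)ˣ) : QPDO δ).coeff (n - 2)) := by
  set Z := ((yUnit δ s ^ i : (QPDO δ)ˣ) : QPDO δ) with hZ
  have h1 := lie_mono_neg_two_coeff hs Z n
  have h0 : mono δ (-2) (s : R) * Z - Z * mono δ (-2) (s : R) =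
      i * (C δ (algebraMap ℂ R e) * Z) := by
    rw [hZ, ← lie_mono_neg_two_zpow hs, mul_add, add_sub_cancel_left, ← hZ, commute_C (by simp)]
    rw [← mul_assoc, ← mul_assoc, (Int.cast_commute i Z).eq]
  have hi : ∀ q : QPDO δ, ((i : QPDO δ) * q).coeff n = i * q.coeff n := fun q => by
    rw [← zsmul_eq_mul, ← zsmul_eq_mul]
    exact map_zsmul (AddMonoidHom.mk' (fun q : QPDO δ => q.coeff n) fun _ _ => rfl) i q
  rw [h0, hi, C_mul_coeff] at h1
  -- The second relation: `u⁻²` commutes with `Z = uⁱ`. Here `δ(δ(s²)) = 2 e²` brings in the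
  -- coefficient of degree `n - 2`.
  have h2 : mono δ (-2) ((s ^ 2 : Rˣ) : R) * Z = Z * mono δ (-2) ((s ^ 2 : Rˣ) : R) := by
    rw [← yUnit_zpow_neg_two, hZ, ← Units.val_mul, ← Units.val_mul, ← zpow_add, ← zpow_add,
      add_comm]
  have h3 := congrArg (fun q : QPDO δ => 2 * q.coeff n) h2
  have hd2 : δ (δ ((s ^ 2 : Rˣ) : R)) = 2 * (algebraMap ℂ R e) ^ 2 := by
    rw [deriv_sq_units hs, two_mul, map_add, Derivation.leibniz, hs]
    simp
    ring
  rw [mono_neg_two_mul_coeff, mul_mono_neg_two_coeff_quadratic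
    (by rw [hd2, ← map_pow, two_mul]; simp), hd2, deriv_sq_units hs, Units.val_pow_eq_pow_val] at h3
  have hu : IsUnit (2 * algebraMap ℂ R e) := isUnit_two.mul ((IsUnit.mk0 e he).map _)
  refine hu.mul_left_cancel ?_
  push_cast
  -- Both relations contain `δ (Z.coeff n)`; this combination eliminates it. The common factor `2 e`
  -- has already been put on both sides, which is where `e ≠ 0` is needed.
  linear_combination h3 + 2 * (s : R) * h1

end YImage
end QPDO

/-! ### Closed form of the powers and of the action on series -/

namespace QPDO

/-- The coefficient of `cˡ s^(-i - l) y^(i + 2l)` in the `i`-th power of the image of `y` under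
the homographic action, where `s` is affine with slope `c`. -/
noncomputable def powerCoef (c : ℂ) (i : ℤ) (l : ℕ) : ℂ :=
  ∏ j ∈ Finset.range l, ((i + 2 * j) * (i + 2 * j + 2) * c / (4 * (j + 1)))

theorem powerCoef_succ (c : ℂ) (i : ℤ) (l : ℕ) : powerCoef c i (l + 1) =
    powerCoef c i l * ((i + 2 * l) * (i + 2 * l + 2) * c / (4 * (l + 1))) :=
  Finset.prod_range_succ ..

section

variable {R : Type*} [CommRing R] [Algebra ℂ R] {δ : Derivation ℂ R R} {s : Rˣ}

theorem smul_cancel {a : ℂ} (ha : a ≠ 0) {p q : R} (h : a • p = a • q) : p = q :=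
  smul_right_injective R ha h

/-- The recursion was obtained by cancelling `δ s`, so the case of zero slope needs its own
treatment: `s` is then central and `s⁻¹ y` is already the square root. -/
theorem yUnit_zpow_of_const (hs : δ s = 0) (i : ℤ) :
    ((yUnit δ s ^ i : (QPDO δ)ˣ) : QPDO δ) = mono δ i ((s ^ (-i) : Rˣ) : R) := by
  have hs' : ∀ n : ℤ, δ ((s ^ n : Rˣ) : R) = 0 := by
    have hinv : δ ((s⁻¹ : Rˣ) : R) = 0 := by
      rw [Derivation.leibniz_of_mul_eq_one δ (Units.inv_mul s), hs, smul_zero]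
    intro n
    induction n using Int.induction_on with
    | zero => simp
    | succ n ih => rw [zpow_add_one, Units.val_mul, Derivation.leibniz, ih, hs]; simp
    | pred n ih => rw [zpow_sub_one, Units.val_mul, Derivation.leibniz, ih, hinv]; simp
  have hone : yImage δ s = mono δ 1 ((s ^ (-1 : ℤ) : Rˣ) : R) := by
    refine sqrt_unique (e := s ^ (-1 : ℤ)) (yImage_spec δ s).1 (valGE_mono _ _) ?_ ?_ ?_
    · rw [(yImage_spec δ s).2.1, zpow_neg_one]
    · rw [mono_coeff, if_pos rfl]
    · rw [(yImage_spec δ s).2.2, y_sq, mono_mul_mono _ _ _ (hs' _), mono_mul_mono _ _ _ (hs' _),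
        one_mul, ← Units.val_mul, ← zpow_add]
      rfl
  have hstep : ∀ i : ℤ, mono δ i ((s ^ (-i) : Rˣ) : R) * (yUnit δ s : QPDO δ) =
      mono δ (i + 1) ((s ^ (-(i + 1)) : Rˣ) : R) := fun i => by
    rw [yUnit_val, hone, mono_mul_mono _ _ _ (hs' _), ← Units.val_mul, ← zpow_add, neg_add]
  induction i using Int.induction_on with
  | zero => rw [zpow_zero, neg_zero, zpow_zero]; rfl
  | succ i ih => rw [zpow_add_one, Units.val_mul, ih, hstep]
  | pred i ih =>
    rw [← (yUnit δ s).mul_left_inj, hstep, ← Units.val_mul, ← zpow_add_one, sub_add_cancel, ih]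

variable {c : ℂ}

/-- With `e = -c/2` and `n = i + 2(l + 1)`, the factor `i - n = -2(l + 1)` of the recursion is
invertible, so the coefficient `s^(-i)` of `yⁱ` determines the others. -/
theorem yUnit_zpow_coeff (hs : δ s = algebraMap ℂ R (-(1 / 2) * c)) (i : ℤ) (l : ℕ) :
    ((yUnit δ s ^ i : (QPDO δ)ˣ) : QPDO δ).coeff (i + 2 * l) =
      powerCoef c i l • ((s ^ (-i - l) : Rˣ) : R) := by
  rcases eq_or_ne c 0 with rfl | hc
  · rw [yUnit_zpow_of_const (by simpa using hs), mono_coeff]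
    rcases l with _ | l
    · simp [powerCoef]
    · rw [if_neg (by push_cast; lia), powerCoef_succ]
      simp
  induction l with
  | zero => simpa [powerCoef] using yUnit_zpow_leading s i
  | succ l ih =>
    have h := yUnit_zpow_coeff_rec hs (by simpa using hc) i (i + 2 * (l + 1 : ℕ))
    rw [show i + 2 * ((l + 1 : ℕ) : ℤ) - 2 = i + 2 * l by push_cast; ring, ih] at h
    have hl : (l : ℂ) + 1 ≠ 0 := Nat.cast_add_one_ne_zero l
    have hr : ∀ (n : ℤ) (r : R), (n : R) * r = (n : ℂ) • r := fun n r => by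
      rw [← zsmul_eq_mul, Int.cast_smul_eq_zsmul]
    rw [hr, hr, ← Algebra.smul_def, smul_smul, smul_smul] at h
    rw [← Units.mul_right_inj s]
    have hsz : (s : R) * ((s ^ (-i - (l + 1 : ℕ)) : Rˣ) : R) = ((s ^ (-i - l) : Rˣ) : R) := by
      rw [← Units.val_mul, ← zpow_one_add]
      congr 2
      push_cast
      ring
    rw [mul_smul_comm, hsz, powerCoef_succ]
    refine smul_cancel (a := ((i - (i + 2 * (l + 1 : ℕ)) : ℤ) : ℂ)) ?_ ?_
    · push_cast
      intro h0
      exact hl (by linear_combination (-1 / 2 : ℂ) * h0)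
    · rw [h, smul_smul]
      congr 1
      push_cast
      field_simp
      ring

theorem yUnit_zpow_coeff_eq_zero (hs : δ s = algebraMap ℂ R (-(1 / 2) * c)) (i N : ℤ)
    (hN : ∀ l : ℕ, N ≠ i + 2 * l) : ((yUnit δ s ^ i : (QPDO δ)ˣ) : QPDO δ).coeff N = 0 := by
  rcases eq_or_ne c 0 with rfl | hc
  · rw [yUnit_zpow_of_const (by simpa using hs), mono_coeff, if_neg (by simpa using hN 0)]
  -- Degrees of the other parity: the recursion starts from degree `i - 1`, below the valuation, and
  -- its factor `i - n` is odd, hence nonzero.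
  have key : ∀ l : ℕ, ((yUnit δ s ^ i : (QPDO δ)ˣ) : QPDO δ).coeff (i - 1 + 2 * l) = 0 := by
    intro l
    induction l with
    | zero => exact valGE_yUnit_zpow s i _ (by simp)
    | succ l ih =>
      have h := yUnit_zpow_coeff_rec hs (by simpa using hc) i (i - 1 + 2 * (l + 1 : ℕ))
      rw [show i - 1 + 2 * ((l + 1 : ℕ) : ℤ) - 2 = i - 1 + 2 * l by push_cast; ring, ih, mul_zero,
        mul_zero, ← zsmul_eq_mul, ← Int.cast_smul_eq_zsmul ℂ] at h
      have hne : ((i - (i - 1 + 2 * (l + 1 : ℕ)) : ℤ) : ℂ) ≠ 0 := Int.cast_ne_zero.2 (by lia)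
      exact s.isUnit.mul_right_eq_zero.1 (smul_cancel hne (h.trans (smul_zero _).symm))
  rcases lt_or_ge N i with h | h
  · exact valGE_yUnit_zpow s i N h
  · rcases Int.even_or_odd' (N - i) with ⟨t, ht | ht⟩
    · exact absurd (by lia) (hN t.toNat)
    · have := key (t + 1).toNat
      rwa [show i - 1 + 2 * ((t + 1).toNat : ℤ) = N by lia] at this

theorem extAct_series_coeff (hs : δ s = algebraMap ℂ R (-(1 / 2) * c)) (g : R →+* R) (m : ℤ)
    (a : ℕ → R) (M : ℕ) : (extAct g s (series δ m a)).coeff (m + 2 * M) =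
      ∑ jl ∈ Finset.HasAntidiagonal.antidiagonal M,
        powerCoef c (m + 2 * jl.1) jl.2 • (g (a jl.1) * ((s ^ (-m - 2 * jl.1 - jl.2) : Rˣ) : R)) := by
  classical
  -- In degree `m + 2M`, only the terms `a j` with `j ≤ M` contribute: higher powers of the image of
  -- `y` have too large a valuation.
  rw [extAct_coeff, finsum_eq_sum_of_support_subset
    (s := (Finset.range (M + 1)).image fun j : ℕ => m + 2 * (j : ℤ)), Finset.sum_image,
    Finset.Nat.sum_antidiagonal_eq_sum_range_succ_mk]
  · refine Finset.sum_congr rfl fun j hj => ?_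
    have hj' : j ≤ M := by simpa [Nat.lt_succ_iff] using hj
    rw [series_coeff, show m + 2 * (M : ℤ) = m + 2 * j + 2 * (M - j : ℕ) by
      push_cast [hj']; ring, yUnit_zpow_coeff hs, mul_smul_comm, neg_add, ← sub_eq_add_neg]
  · intro x _ y _ h
    simpa using h
  · intro n hn
    by_contra hn'
    refine hn ?_
    simp only
    by_cases h : ∃ j : ℕ, n = m + 2 * j
    · obtain ⟨j, rfl⟩ := h
      have hj : M < j := by
        by_contra hlt
        exact hn' (Finset.mem_coe.2 (Finset.mem_image.2 ⟨j, Finset.mem_range.2 (by lia), rfl⟩))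
      rw [valGE_yUnit_zpow s _ _ (by lia), mul_zero]
    · push Not at h
      rw [series_coeff_eq_zero _ _ _ h, map_zero, zero_mul]

theorem extAct_series_coeff_eq_zero (hs : δ s = algebraMap ℂ R (-(1 / 2) * c)) (g : R →+* R)
    (m : ℤ) (a : ℕ → R) (N : ℤ) (hN : ∀ n : ℕ, N ≠ m + 2 * n) :
    (extAct g s (series δ m a)).coeff N = 0 := by
  rw [extAct_coeff]
  refine finsum_eq_zero_of_forall_eq_zero fun n => ?_
  by_cases h : ∃ j : ℕ, n = m + 2 * j
  · obtain ⟨j, rfl⟩ := h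
    rw [yUnit_zpow_coeff_eq_zero hs _ _ fun l hl => hN (j + l) (by push_cast; lia), mul_zero]
  · push Not at h
    rw [series_coeff_eq_zero _ _ _ h, map_zero, zero_mul]

end

/-! ### Iterated derivatives of the weight action -/

/-- The coefficient of `s^(-m - 2j - l) g(Dʲ f)` in `D^(j + l) (s^(-m) g(f))`. -/
noncomputable def derivCoef (c : ℂ) (m : ℤ) (j l : ℕ) : ℂ :=
  (j + l).choose j * ∏ i ∈ Finset.range l, (-c * (m + j + i))

theorem derivCoef_zero (c : ℂ) (m : ℤ) (j : ℕ) : derivCoef c m j 0 = 1 := by simp [derivCoef]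

theorem derivCoef_succ (c : ℂ) (m : ℤ) (j l : ℕ) : derivCoef c m j (l + 1) =
    derivCoef c m j l * ((j + l + 1) / (l + 1) * (-c * (m + j + l))) := by
  have h : (((j + (l + 1)).choose j : ℕ) : ℂ) * (l + 1) = (j + l).choose j * (j + l + 1) := by
    have := Nat.add_one_mul_choose_eq (j + l) l
    rw [Nat.choose_symm_add, Nat.choose_symm_add, ← add_assoc]
    exact_mod_cast (by linarith)
  have hl : (l : ℂ) + 1 ≠ 0 := Nat.cast_add_one_ne_zero l
  rw [derivCoef, derivCoef, Finset.prod_range_succ]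
  generalize ∏ i ∈ Finset.range l, (-c * ((m : ℂ) + j + i)) = P
  field_simp
  linear_combination (-P * c * (m + j + l)) * h

theorem derivCoef_zero_succ (c : ℂ) (m : ℤ) (l : ℕ) :
    derivCoef c m 0 (l + 1) = derivCoef c m 0 l * (-c * (m + l)) := by
  have hl : (l : ℂ) + 1 ≠ 0 := Nat.cast_add_one_ne_zero l
  rw [derivCoef_succ]
  push_cast
  field_simp
  ring

/-- This is the Pascal-type rule produced by one more differentiation: either the power of `s` is
differentiated (`l` grows) or `g(Dʲ f)` is (`j` grows). -/
theorem derivCoef_succ_succ (c : ℂ) (m : ℤ) (j l : ℕ) : derivCoef c m (j + 1) (l + 1) =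
    derivCoef c m (j + 1) l * (-c * (m + 2 * (j + 1) + l)) + derivCoef c m j (l + 1) := by
  have h1 : (((j + 1 + (l + 1)).choose (j + 1) : ℕ) : ℂ) =
      (j + (l + 1)).choose j + (j + 1 + l).choose (j + 1) := by
    rw [show j + 1 + (l + 1) = (j + (l + 1)) + 1 by ring, Nat.choose_succ_succ,
      show j + (l + 1) = j + 1 + l by ring]
    push_cast
    ring
  have h2 : (((j + 1 + l).choose (j + 1) : ℕ) : ℂ) * (j + 1) = (j + (l + 1)).choose j * (l + 1) := by
    have := Nat.choose_succ_right_eq (j + (l + 1)) j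
    rw [Nat.add_sub_cancel_left] at this
    rw [show j + 1 + l = j + (l + 1) by ring]
    exact_mod_cast this
  rw [derivCoef, derivCoef, derivCoef, Finset.prod_range_succ, Finset.prod_range_succ' _ l, h1]
  have hp : ∏ i ∈ Finset.range l, (-c * ((m : ℂ) + j + ((i + 1 : ℕ) : ℂ))) =
      ∏ i ∈ Finset.range l, (-c * ((m : ℂ) + (j + 1 : ℕ) + i)) :=
    Finset.prod_congr rfl fun i _ => by push_cast; ring
  rw [hp]
  push_cast
  linear_combination c * (∏ i ∈ Finset.range l, (-c * ((m : ℂ) + (j + 1) + i))) * h2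

section

variable {R : Type*} [CommRing R] [Algebra ℂ R] {D : Derivation ℂ R R} {s : Rˣ} {c : ℂ}

theorem deriv_units_zpow (hs : D s = algebraMap ℂ R c) (n : ℤ) :
    D ((s ^ n : Rˣ) : R) = (n * c) • ((s ^ (n - 1) : Rˣ) : R) := by
  have hinv : D ((s⁻¹ : Rˣ) : R) = -(c • ((s ^ (-2 : ℤ) : Rˣ) : R)) := by
    rw [Derivation.leibniz_of_mul_eq_one D (Units.inv_mul s), hs, smul_eq_mul,
      show s ^ (-2 : ℤ) = s⁻¹ ^ 2 by group, Units.val_pow_eq_pow_val, Algebra.smul_def c]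
    ring
  have hm : ∀ a b : ℤ, ((s ^ a : Rˣ) : R) * ((s ^ b : Rˣ) : R) = ((s ^ (a + b) : Rˣ) : R) :=
    fun a b => by rw [zpow_add, Units.val_mul]
  induction n using Int.induction_on with
  | zero => simp
  | succ n ih =>
    rw [zpow_add_one, Units.val_mul, Derivation.leibniz, ih, hs, smul_eq_mul, smul_eq_mul,
      mul_smul_comm, mul_comm _ (algebraMap ℂ R c), ← Algebra.smul_def, ← Units.val_mul,
      ← zpow_one_add, add_sub_cancel, add_sub_cancel_right, ← add_smul]
    congr 1
    push_cast
    ring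
  | pred n ih =>
    rw [zpow_sub_one, Units.val_mul, Derivation.leibniz, ih, hinv, smul_eq_mul, smul_eq_mul,
      mul_neg, mul_smul_comm, mul_smul_comm, ← zpow_neg_one, hm, hm, add_comm (-1 : ℤ),
      show -(n : ℤ) - 1 + -1 = -n - 1 - 1 by ring, show -(n : ℤ) + -2 = -n - 1 - 1 by ring,
      ← neg_smul, ← add_smul]
    congr 1
    push_cast
    ring

/-- Hypothesis `hg` is the chain rule for a homography of determinant one. Each derivative of `g(Dʲ
f)` lowers the exponent of `s` by two, each derivative of the power of `s` by one, so `j` and `l`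
determine the monomial. -/
theorem iterate_deriv_weight (hs : D s = algebraMap ℂ R c) (g : R →+* R)
    (hg : ∀ f, D (g f) = ((s ^ (-2 : ℤ) : Rˣ) : R) * g (D f)) (m : ℤ) (f : R) (M : ℕ) :
    D^[M] (((s ^ (-m) : Rˣ) : R) * g f) = ∑ jl ∈ Finset.HasAntidiagonal.antidiagonal M,
      derivCoef c m jl.1 jl.2 • (g (D^[jl.1] f) * ((s ^ (-m - 2 * jl.1 - jl.2) : Rˣ) : R)) := by
  set G : ℕ → ℕ → R := fun j l => g (D^[j] f) * ((s ^ (-m - 2 * j - l : ℤ) : Rˣ) : R) with hG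
  have hDG : ∀ j l, D (G j l) = (-c * (m + 2 * j + l)) • G j (l + 1) + G (j + 1) l := by
    intro j l
    simp only [hG]
    have h1 : -m - 2 * (j : ℤ) - l - 1 = -m - 2 * j - (l + 1 : ℕ) := by push_cast; ring
    have h2 : -m - 2 * (j : ℤ) - l + -2 = -m - 2 * (j + 1 : ℕ) - l := by push_cast; ring
    rw [Derivation.leibniz, hg, deriv_units_zpow hs, smul_eq_mul, smul_eq_mul, mul_smul_comm,
      Function.iterate_succ_apply' D, ← mul_assoc, ← Units.val_mul, ← zpow_add, h1, h2,
      mul_comm _ (g (D _))]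
    congr 2
    push_cast
    ring
  change _ = ∑ jl ∈ Finset.HasAntidiagonal.antidiagonal M, derivCoef c m jl.1 jl.2 • G jl.1 jl.2
  induction M with
  | zero => simp [derivCoef, hG, mul_comm]
  | succ M ih =>
    -- `A` and `B` collect the two contributions to the derivative, reindexed on the antidiagonal of
    -- `M + 1`; each is zero on the edge that it cannot reach.
    let a : ℕ → ℕ → ℂ := fun j l => derivCoef c m j l * (-c * (m + 2 * j + l))
    let A : ℕ × ℕ → R := fun jl => Nat.casesOn jl.2 0 fun l => a jl.1 l • G jl.1 (l + 1)
    let B : ℕ × ℕ → R := fun jl => Nat.casesOn jl.1 0 fun j => derivCoef c m j jl.2 • G (j + 1) jl.2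
    have hAB : ∀ jl ∈ Finset.HasAntidiagonal.antidiagonal (M + 1),
        derivCoef c m jl.1 jl.2 • G jl.1 jl.2 = A jl + B jl := by
      rintro ⟨_ | j, _ | l⟩ h
      · simp at h
      · simp only [A, B, a, derivCoef_zero_succ]
        simp
      · simp [A, B, derivCoef_zero]
      · simp only [A, B, a]
        rw [derivCoef_succ_succ, add_smul]
        push_cast
        rfl
    rw [Function.iterate_succ_apply', ih, map_sum, Finset.sum_congr rfl hAB,
      Finset.sum_add_distrib, Finset.Nat.sum_antidiagonal_succ', Finset.Nat.sum_antidiagonal_succ]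
    simp [A, B, a, Finset.sum_add_distrib, hDG, smul_smul]

theorem iterate_deriv_pow {z : R} (hz : D z = 1) (n j : ℕ) :
    D^[j] (z ^ n) = (n.descFactorial j : R) * z ^ (n - j) := by
  induction j with
  | zero => simp
  | succ j ih =>
    rw [Function.iterate_succ_apply', ih, ← nsmul_eq_mul, map_nsmul, Derivation.leibniz_pow, hz,
      Nat.descFactorial_succ, Nat.sub_sub]
    simp
    ring

end

end QPDO

/-! ### Differentiation of homographies and pullbacks -/

namespace GenFun

variable {Ω : TopologicalSpace.Opens ℂ}

theorem hasDerivAt_denom (γ : Matrix.SpecialLinearGroup (Fin 2) ℂ) (z : ℂ) :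
    HasDerivAt (denom γ) (γ 1 0) z := by
  unfold denom
  simpa using ((hasDerivAt_id z).const_mul (γ 1 0)).add_const (γ 1 1)

theorem hasDerivAt_homography {γ : Matrix.SpecialLinearGroup (Fin 2) ℂ} {z : ℂ}
    (hz : denom γ z ≠ 0) : HasDerivAt (homography γ) ((denom γ z)⁻¹ ^ 2) z := by
  have h1 : HasDerivAt (fun z => γ 0 0 * z + γ 0 1) (γ 0 0) z := by
    simpa using ((hasDerivAt_id z).const_mul (γ 0 0)).add_const (γ 0 1)
  have := det_eq γ
  refine (h1.div (hasDerivAt_denom γ z) hz).congr_deriv (Eq.symm ?_)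
  rw [inv_pow, eq_div_iff (pow_ne_zero 2 hz), inv_mul_cancel₀ (pow_ne_zero 2 hz)]
  simp only [denom]
  linear_combination -this

theorem deriv_pullback (γ : Matrix.SpecialLinearGroup (Fin 2) ℂ)
    (h : ∀ z ∈ Ω, denom γ z ≠ 0 → homography γ z ∈ Ω) {f : GenFun Ω} (hf : IsHolomorphic f) :
    deriv (pullback γ h f) =
      ((fun z => (denom γ z)⁻¹ : ℂ → ℂ) : GenFun Ω) ^ 2 * pullback γ h (deriv f) := by
  obtain ⟨F, rfl, hF⟩ := hf
  refine Filter.Germ.coe_eq.2 ?_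
  filter_upwards [(tendsto_homography h).eventually hF, eventually_denom_ne_zero γ] with z h1 h2
  exact (h1.hasDerivAt.comp z (hasDerivAt_homography h2)).deriv.trans (mul_comm _ _)

theorem deriv_denom (γ : Matrix.SpecialLinearGroup (Fin 2) ℂ) :
    deriv (denom γ : GenFun Ω) = algebraMap ℂ (GenFun Ω) (γ 1 0) := by
  rw [Algebra.algebraMap_eq_smul_one]
  refine Filter.Germ.coe_eq.2 (Filter.Eventually.of_forall fun z => ?_)
  simpa using (hasDerivAt_denom γ z).deriv

theorem pullback_smul (γ : Matrix.SpecialLinearGroup (Fin 2) ℂ)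
    (h : ∀ z ∈ Ω, denom γ z ≠ 0 → homography γ z ∈ Ω) (c : ℂ) (f : GenFun Ω) :
    pullback γ h (c • f) = c • pullback γ h f := by
  induction f using Filter.Germ.inductionOn with | _ F
  rfl

end GenFun

/-! ### Equivariance as identities between coefficients -/

namespace HomographicAlgebra

open QPDO

variable {Γ : Subgroup (Matrix.SpecialLinearGroup (Fin 2) ℂ)} (A : HomographicAlgebra Γ)

/-- The lower left entry of an element of `Γ`. -/
def slope (γ : Γ) : ℂ := (γ : Matrix.SpecialLinearGroup (Fin 2) ℂ) 1 0

theorem D_s (γ : Γ) : A.D (A.s γ) = algebraMap ℂ A.R (slope γ) :=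
  Subtype.ext (GenFun.deriv_denom _)

theorem δ_s (γ : Γ) : A.δ (A.s γ) = algebraMap ℂ A.R (-(1 / 2) * slope γ) := by
  rw [δ, Derivation.smul_apply, D_s, Algebra.algebraMap_eq_smul_one,
    Algebra.algebraMap_eq_smul_one, smul_smul]

theorem D_act (γ : Γ) (f : A.R) :
    A.D (A.act γ f) = ((A.s γ ^ (-2 : ℤ) : A.Rˣ) : A.R) * A.act γ (A.D f) := by
  rw [show A.s γ ^ (-2 : ℤ) = (A.s γ)⁻¹ ^ 2 by group, Units.val_pow_eq_pow_val]
  exact Subtype.ext (GenFun.deriv_pullback _ (A.stable γ γ.2) (A.isHolomorphic f f.2))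

theorem act_smul (γ : Γ) (c : ℂ) (f : A.R) : A.act γ (c • f) = c • A.act γ f :=
  Subtype.ext (GenFun.pullback_smul _ (A.stable γ γ.2) c f)

theorem iterate_D_weightAct (m : ℤ) (γ : Γ) (f : A.R) (M : ℕ) :
    A.D^[M] (A.weightAct m γ f) = ∑ jl ∈ Finset.HasAntidiagonal.antidiagonal M,
      derivCoef (slope γ) m jl.1 jl.2 •
        (A.act γ (A.D^[jl.1] f) * ((A.s γ ^ (-m - 2 * jl.1 - jl.2) : A.Rˣ) : A.R)) :=
  iterate_deriv_weight (A.D_s γ) (A.act γ) (A.D_act γ) m f M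

theorem seriesMap_coeff (m : ℤ) (α : ℕ → ℂ) (f : A.R) (M : ℕ) :
    (A.seriesMap m α f).coeff (m + 2 * M) = α M • A.D^[M] f :=
  series_coeff m (fun n => α n • A.D^[n] f) M

theorem seriesMap_coeff_eq_zero (m : ℤ) (α : ℕ → ℂ) (f : A.R) {N : ℤ}
    (hN : ∀ n : ℕ, N ≠ m + 2 * n) : (A.seriesMap m α f).coeff N = 0 :=
  series_coeff_eq_zero m (fun n => α n • A.D^[n] f) N hN

/-- Both sides are supported in degrees `m + 2M`, and there both are combinations of the same
elements `g(Dʲ f) s^(-m - 2j - l)` with `j + l = M`. Subtracting leaves one scalar per pair `(j,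
l)`. -/
theorem seriesMap_weightAct_eq_iff (m : ℤ) (α : ℕ → ℂ) (γ : Γ) (f : A.R) :
    A.seriesMap m α (A.weightAct m γ f) = A.actC γ (A.seriesMap m α f) ↔
      ∀ M : ℕ, ∑ jl ∈ Finset.HasAntidiagonal.antidiagonal M,
        (α M * derivCoef (slope γ) m jl.1 jl.2 - α jl.1 * powerCoef (slope γ) (m + 2 * jl.1) jl.2) •
          (A.act γ (A.D^[jl.1] f) * ((A.s γ ^ (-m - 2 * jl.1 - jl.2) : A.Rˣ) : A.R)) = 0 := by
  have key : ∀ M : ℕ, (A.seriesMap m α (A.weightAct m γ f)).coeff (m + 2 * M) -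
      (A.actC γ (A.seriesMap m α f)).coeff (m + 2 * M) =
      ∑ jl ∈ Finset.HasAntidiagonal.antidiagonal M,
        (α M * derivCoef (slope γ) m jl.1 jl.2 - α jl.1 * powerCoef (slope γ) (m + 2 * jl.1) jl.2) •
          (A.act γ (A.D^[jl.1] f) * ((A.s γ ^ (-m - 2 * jl.1 - jl.2) : A.Rˣ) : A.R)) := by
    intro M
    have h : (A.actC γ (A.seriesMap m α f)).coeff (m + 2 * M) = _ :=
      extAct_series_coeff (A.δ_s γ) (A.act γ) m (fun n => α n • A.D^[n] f) M
    rw [seriesMap_coeff, iterate_D_weightAct, h, Finset.smul_sum, ← Finset.sum_sub_distrib]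
    refine Finset.sum_congr rfl fun jl _ => ?_
    rw [act_smul, smul_mul_assoc, smul_smul, smul_smul, sub_smul, mul_comm (α jl.1)]
  constructor
  · intro h M
    rw [← key, h, sub_self]
  · intro h
    ext1 N
    by_cases hN : ∃ n : ℕ, N = m + 2 * n
    · obtain ⟨n, rfl⟩ := hN
      rw [← sub_eq_zero, key, h]
    · push Not at hN
      have h0 : (A.actC γ (A.seriesMap m α f)).coeff N = 0 :=
        extAct_series_coeff_eq_zero (A.δ_s γ) (A.act γ) m (fun n => α n • A.D^[n] f) N hN
      rw [A.seriesMap_coeff_eq_zero _ _ _ hN, h0]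

/-! ### Equivariance in positive weight -/

theorem splittingCoef_zero (m : ℕ) : splittingCoef m 0 = 1 := by simp [splittingCoef]

theorem splittingCoef_succ (m n : ℕ) : splittingCoef m (n + 1) =
    splittingCoef m n * (-((m + 2 * n) * (m + 2 * n + 2)) / (4 * (n + 1) * (m + n))) := by
  rw [splittingCoef, splittingCoef, Finset.prod_range_succ, Nat.factorial_succ]
  generalize ∏ i ∈ Finset.range n, (((m : ℂ) + 2 * i) * ((m : ℂ) + 2 * i + 2) / ((m : ℂ) + i)) = P
  have := Nat.cast_ne_zero (R := ℂ).2 (Nat.factorial_ne_zero n)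
  have h4 : (4 : ℂ) ^ n ≠ 0 := pow_ne_zero _ (by norm_num)
  have hn : (n : ℂ) + 1 ≠ 0 := Nat.cast_add_one_ne_zero n
  push_cast
  rw [pow_succ, pow_succ]
  rcases eq_or_ne ((m : ℂ) + n) 0 with h0 | h0
  · simp [h0]
  · field_simp

/-- Passing from `l` to `l + 1` multiplies both sides by `(m + 2j + 2l)(m + 2j + 2l + 2) c / (4(l +
1))`: the factors `j + l + 1` and `m + j + l` cancel between `splittingCoef` and `derivCoef`.
Positivity of `m` ensures `m + j + l ≠ 0`. -/
theorem splittingCoef_mul_derivCoef (c : ℂ) {m : ℕ} (hm : 0 < m) (j l : ℕ) :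
    splittingCoef m (j + l) * derivCoef c m j l =
      splittingCoef m j * powerCoef c (m + 2 * j) l := by
  induction l with
  | zero => simp [derivCoef_zero, powerCoef]
  | succ l ih =>
    rw [← add_assoc, splittingCoef_succ, derivCoef_succ, powerCoef_succ,
      ← mul_assoc _ (powerCoef _ _ _), ← ih]
    have h1 : (j : ℂ) + l + 1 ≠ 0 := by exact_mod_cast Nat.succ_ne_zero (j + l)
    have h2 : (m : ℂ) + j + l ≠ 0 := by exact_mod_cast (by lia : m + j + l ≠ 0)
    have h2' : (m : ℂ) + (j + l) ≠ 0 := by rwa [← add_assoc]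
    have h3 : (l : ℂ) + 1 ≠ 0 := Nat.cast_add_one_ne_zero l
    push_cast
    field_simp
    ring

theorem isEquivariant_splitting {m : ℕ} (hm : 0 < m) : A.IsEquivariant m (A.splitting m) := by
  intro γ f
  refine (A.seriesMap_weightAct_eq_iff m _ γ f).2 fun M => Finset.sum_eq_zero fun jl hjl => ?_
  rw [Finset.HasAntidiagonal.mem_antidiagonal] at hjl
  rw [← hjl, splittingCoef_mul_derivCoef _ hm, sub_self, zero_smul]

/-! ### Weight `1 - 2k`: Bol's lemma and the derived splitting -/

theorem derivCoef_eq_zero (c : ℂ) {k j l : ℕ} (hj : j < 2 * k) (hl : 2 * k ≤ j + l) :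
    derivCoef c (-2 * k + 1) j l = 0 := by
  -- The factor `1 - 2k + j + i` vanishes at `i = 2k - 1 - j`, and this index is below `l` precisely
  -- because `2k ≤ j + l`.
  rw [derivCoef, Finset.prod_eq_zero (i := 2 * k - 1 - j) (by simp; lia), mul_zero]
  rw [Nat.cast_sub (by lia), Nat.cast_sub (by lia)]
  push_cast
  ring

/-- Bol's lemma. -/
theorem iterate_D_weightAct_bol (k : ℕ) (γ : Γ) (f : A.R) :
    A.D^[2 * k] (A.weightAct (-2 * k + 1) γ f) =
      A.weightAct (2 * k + 1 : ℕ) γ (A.D^[2 * k] f) := by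
  rw [iterate_D_weightAct, Finset.sum_eq_single (2 * k, 0), derivCoef_zero, one_smul, weightAct,
    mul_comm]
  · congr 4
    push_cast
    ring
  · rintro ⟨j, l⟩ h hne
    rw [Finset.HasAntidiagonal.mem_antidiagonal] at h
    simp only at h
    -- Every pair other than `(2k, 0)` has `j < 2k` and `j + l = 2k`, hence a zero coefficient.
    have : j < 2 * k := by
      by_contra hj
      exact hne (Prod.ext (by simp only; lia) (by simp only; lia))
    rw [derivCoef_eq_zero _ this h.ge, zero_smul]
  · intro h
    simp at h

theorem derivedSplitting_apply (k : ℕ) (f : A.R) :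
    A.derivedSplitting k f = A.splitting (2 * k + 1) (A.D^[2 * k] f) := by
  rw [derivedSplitting, LinearMap.comp_apply, Module.End.pow_apply]
  rfl

theorem isEquivariant_derivedSplitting (k : ℕ) :
    A.IsEquivariant (-2 * k + 1) (A.derivedSplitting k) := by
  intro γ f
  rw [derivedSplitting_apply, iterate_D_weightAct_bol, derivedSplitting_apply]
  exact A.isEquivariant_splitting (Nat.succ_pos _) γ _

/-- The coefficients of the map `derivedSplitting`. -/
noncomputable def derivedCoef (k n : ℕ) : ℂ :=
  if 2 * k ≤ n then splittingCoef (2 * k + 1) (n - 2 * k) else 0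

theorem derivedCoef_two_mul (k : ℕ) : derivedCoef k (2 * k) = 1 := by
  rw [derivedCoef, if_pos le_rfl, Nat.sub_self, splittingCoef_zero]

/-- The series of `ψ_(2k+1)` begins at `y^(2k+1)`, which is the term of index `2k` counted from
`y^(1-2k)`; hence the `2k` leading zeros. -/
theorem hasForm_derivedSplitting (k : ℕ) :
    A.HasForm (-2 * k + 1) (A.derivedSplitting k) (derivedCoef k) := by
  refine LinearMap.ext fun f => ?_
  rw [derivedSplitting_apply, splitting]
  ext1 N
  by_cases hN : ∃ n : ℕ, N = -2 * k + 1 + 2 * n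
  · obtain ⟨n, rfl⟩ := hN
    rw [seriesMap_coeff, derivedCoef]
    split_ifs with h
    · rw [show (-2 * k + 1 + 2 * n : ℤ) = (2 * k + 1 : ℕ) + 2 * (n - 2 * k : ℕ) by lia,
        seriesMap_coeff, ← Function.iterate_add_apply, Nat.sub_add_cancel h]
    · rw [zero_smul]
      exact A.seriesMap_coeff_eq_zero _ _ _ fun l => by lia
  · push Not at hN
    rw [A.seriesMap_coeff_eq_zero _ _ _ hN]
    refine A.seriesMap_coeff_eq_zero _ _ _ fun l h => hN (l + 2 * k) ?_
    rw [h]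
    push_cast
    ring

/-- For odd `i` the numbers `i + 2j` are odd, so no factor vanishes. -/
theorem powerCoef_ne_zero {c : ℂ} (hc : c ≠ 0) {i : ℤ} (hi : Odd i) (l : ℕ) :
    powerCoef c i l ≠ 0 := by
  refine Finset.prod_ne_zero_iff.2 fun j _ => ?_
  obtain ⟨t, rfl⟩ := hi
  have h1 : (((2 * t + 1 + 2 * j : ℤ)) : ℂ) ≠ 0 := Int.cast_ne_zero.2 (by lia)
  have h2 : (((2 * t + 1 + 2 * j + 2 : ℤ)) : ℂ) ≠ 0 := Int.cast_ne_zero.2 (by lia)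
  have h3 : (j : ℂ) + 1 ≠ 0 := Nat.cast_add_one_ne_zero j
  push_cast at h1 h2 ⊢
  exact div_ne_zero (mul_ne_zero (mul_ne_zero h1 h2) hc) (mul_ne_zero (by norm_num) h3)

/-- The only possible zero factor has index `2k - 1 - j`; it lies beyond the range when `j + l < 2k`
and is negative when `2k ≤ j`. -/
theorem derivCoef_ne_zero {c : ℂ} (hc : c ≠ 0) {k j l : ℕ} (h : j + l < 2 * k ∨ 2 * k ≤ j) :
    derivCoef c (-2 * k + 1) j l ≠ 0 := by
  refine mul_ne_zero (Nat.cast_ne_zero.2 (Nat.choose_pos (Nat.le_add_right _ _)).ne') ?_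
  refine Finset.prod_ne_zero_iff.2 fun i hi => mul_ne_zero (neg_ne_zero.2 hc) ?_
  rw [Finset.mem_range] at hi
  exact_mod_cast (by lia : (-2 * k + 1 + j + i : ℤ) ≠ 0)

/-! ### Uniqueness up to a scalar -/

section Uniqueness

variable {A}

theorem eq_zero_of_smul_unit {a : ℂ} {u : A.R} (hu : IsUnit u) (h : a • u = 0) : a = 0 := by
  have := A.isDomain
  exact (smul_eq_zero.1 h).resolve_right hu.ne_zero

/-- Testing on `f = 1` kills all derivatives, so only the pair `(0, M)` survives, and its monomial
is a unit. -/
theorem coef_of_isEquivariant_zero {m : ℤ} {α : ℕ → ℂ} (h : A.IsEquivariant m (A.seriesMap m α))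
    (γ : Γ) (M : ℕ) :
    α M * derivCoef (slope γ) m 0 M = α 0 * powerCoef (slope γ) m M := by
  have h1 := (A.seriesMap_weightAct_eq_iff m α γ 1).1 (h γ 1) M
  rw [Finset.sum_eq_single (0, M)] at h1
  · simp only [Function.iterate_zero, id, map_one, one_mul] at h1
    simpa [sub_eq_zero] using eq_zero_of_smul_unit (Units.isUnit _) h1
  · rintro ⟨_ | j, l⟩ hjl hne
    · rw [Finset.HasAntidiagonal.mem_antidiagonal] at hjl
      exact absurd (congrArg (Prod.mk 0) ((zero_add l).symm.trans hjl)) hne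
    · simp only [Function.iterate_succ_apply, Derivation.map_one_eq_zero, iterate_map_zero,
        map_zero, zero_mul, smul_zero]
  · intro h0
    simp at h0

theorem exists_deriv_eq_one {γ : Γ} (hγ : slope γ ≠ 0) : ∃ z : A.R, A.D z = 1 := by
  refine ⟨(slope γ)⁻¹ • (A.s γ : A.R), ?_⟩
  rw [Derivation.map_smul, D_s, Algebra.algebraMap_eq_smul_one, smul_smul, inv_mul_cancel₀ hγ,
    one_smul]

theorem iterate_D_pow_self {z : A.R} (hz : A.D z = 1) (n : ℕ) :
    A.D^[n] (z ^ n) = (n.factorial : ℂ) • (1 : A.R) := by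
  rw [iterate_deriv_pow hz, Nat.sub_self, pow_zero, Nat.descFactorial_self,
    Nat.cast_smul_eq_nsmul, nsmul_eq_mul]

theorem coef_eq_zero_of_isEquivariant {k : ℕ} (hk : 0 < k) {α : ℕ → ℂ}
    (h : A.IsEquivariant (-2 * k + 1) (A.seriesMap (-2 * k + 1) α)) {γ : Γ} (hγ : slope γ ≠ 0)
    {n : ℕ} (hn : n < 2 * k) : α n = 0 := by
  have h0 : α 0 = 0 := by
    -- At `M = 2k` the coefficient of `α(2k)` vanishes while that of `α(0)` does not, which forces
    -- `α(0) = 0`.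
    have h1 := coef_of_isEquivariant_zero h γ (2 * k)
    rw [derivCoef_eq_zero _ (by lia) (by lia), mul_zero] at h1
    exact (mul_eq_zero.1 h1.symm).resolve_right
      (powerCoef_ne_zero hγ ⟨-k, by ring⟩ _)
  have h1 := coef_of_isEquivariant_zero h γ n
  rw [h0, zero_mul] at h1
  exact (mul_eq_zero.1 h1).resolve_right (derivCoef_ne_zero hγ (Or.inl (by lia)))

/-- Testing on `z^(2k)` isolates the pair `(2k, l)`: for `j > 2k` the derivative is zero, and for `j
< 2k` both scalars are, the first by the vanishing behind Bol's lemma, the second because `α(j) =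
0`. -/
theorem coef_of_isEquivariant {k : ℕ} (hk : 0 < k) {α : ℕ → ℂ}
    (h : A.IsEquivariant (-2 * k + 1) (A.seriesMap (-2 * k + 1) α)) {γ : Γ} (hγ : slope γ ≠ 0)
    (l : ℕ) : α (2 * k + l) * derivCoef (slope γ) (-2 * k + 1) (2 * k) l =
      α (2 * k) * powerCoef (slope γ) (-2 * k + 1 + 2 * (2 * k : ℕ)) l := by
  obtain ⟨z, hz⟩ := exists_deriv_eq_one (A := A) hγ
  have h1 := (A.seriesMap_weightAct_eq_iff _ α γ _).1 (h γ (z ^ (2 * k))) (2 * k + l)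
  have hf := iterate_D_pow_self hz (2 * k)
  rw [Finset.sum_eq_single (2 * k, l)] at h1
  · simp only [hf, act_smul, map_one, smul_mul_assoc, one_mul, smul_smul] at h1
    have h2 := eq_zero_of_smul_unit (Units.isUnit _) h1
    exact sub_eq_zero.1 ((mul_eq_zero.1 h2).resolve_right
      (Nat.cast_ne_zero.2 (Nat.factorial_ne_zero _)))
  · rintro ⟨j, l'⟩ hjl hne
    rw [Finset.HasAntidiagonal.mem_antidiagonal] at hjl
    simp only at hjl ⊢
    rcases lt_trichotomy j (2 * k) with hj | rfl | hj
    · rw [derivCoef_eq_zero _ hj (by lia), coef_eq_zero_of_isEquivariant hk h hγ hj]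
      simp
    · exact absurd (congrArg (Prod.mk (2 * k)) (Nat.add_left_cancel hjl)) hne
    · obtain ⟨t, rfl⟩ := Nat.exists_eq_add_of_lt hj
      rw [show 2 * k + t + 1 = t + 1 + 2 * k by ring, Function.iterate_add_apply, hf,
        Function.iterate_succ_apply, Derivation.map_smul, Derivation.map_one_eq_zero, smul_zero,
        iterate_map_zero, map_zero, zero_mul, smul_zero]
  · intro h0
    simp at h0

theorem coef_eq_smul_derivedCoef {k : ℕ} (hk : 0 < k) {α : ℕ → ℂ}
    (h : A.IsEquivariant (-2 * k + 1) (A.seriesMap (-2 * k + 1) α)) {γ : Γ} (hγ : slope γ ≠ 0) :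
    α = α (2 * k) • derivedCoef k := by
  funext n
  rw [Pi.smul_apply, smul_eq_mul]
  rcases lt_or_ge n (2 * k) with hn | hn
  · rw [coef_eq_zero_of_isEquivariant hk h hγ hn, derivedCoef, if_neg (by lia), mul_zero]
  · obtain ⟨l, rfl⟩ := Nat.exists_eq_add_of_le hn
    -- The coefficients of `derivedSplitting` satisfy the same recursion with value `1` at index
    -- `2k`, so comparison avoids solving it.
    have h' : A.IsEquivariant (-2 * k + 1) (A.seriesMap (-2 * k + 1) (derivedCoef k)) :=
      A.hasForm_derivedSplitting k ▸ A.isEquivariant_derivedSplitting k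
    have h1 := coef_of_isEquivariant hk h hγ l
    have h2 := coef_of_isEquivariant hk h' hγ l
    rw [derivedCoef_two_mul, one_mul] at h2
    rw [← h2, ← mul_assoc] at h1
    exact mul_right_cancel₀ (derivCoef_ne_zero hγ (Or.inr le_rfl)) h1

end Uniqueness

theorem seriesMap_smul (m : ℤ) (t : ℂ) (α : ℕ → ℂ) :
    A.seriesMap m (t • α) = t • A.seriesMap m α := by
  refine LinearMap.ext fun f => ?_
  ext1 N
  have hc : (t • A.seriesMap m α f).coeff N = t • (A.seriesMap m α f).coeff N :=
    HahnSeries.coeff_smul ..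
  rw [LinearMap.smul_apply, hc]
  by_cases hN : ∃ n : ℕ, N = m + 2 * n
  · obtain ⟨n, rfl⟩ := hN
    rw [seriesMap_coeff, seriesMap_coeff, smul_smul, Pi.smul_apply, smul_eq_mul]
  · push Not at hN
    have h0 : ∀ β : ℕ → ℂ, (A.seriesMap m β f).coeff N = 0 :=
      fun β => A.seriesMap_coeff_eq_zero _ _ _ hN
    rw [h0, h0, smul_zero]

theorem derivedSplitting_ne_zero {γ : Γ} (hγ : slope γ ≠ 0) (k : ℕ) :
    A.derivedSplitting k ≠ 0 := by
  intro h0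
  obtain ⟨z, hz⟩ := exists_deriv_eq_one (A := A) hγ
  -- On `z^(2k)` the coefficient of index `2k` is the nonzero constant `(2k)!`.
  have h1 := A.seriesMap_coeff (-2 * k + 1) (derivedCoef k) (z ^ (2 * k)) (2 * k)
  rw [← A.hasForm_derivedSplitting k, h0, LinearMap.zero_apply, coeff_zero, derivedCoef_two_mul,
    one_smul, iterate_D_pow_self hz] at h1
  exact Nat.cast_ne_zero.2 (Nat.factorial_ne_zero _) (eq_zero_of_smul_unit isUnit_one h1.symm)

end HomographicAlgebra

theorem mainTheorem9 (Γ : Subgroup (Matrix.SpecialLinearGroup (Fin 2) ℂ))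
    (A : HomographicAlgebra Γ) (hΓ : ∃ γ ∈ Γ, γ 1 0 ≠ 0) (k : ℕ) (hk : 0 < k) :
    -- no equivariant map of the prescribed form has `α(0) = 1`
    (¬ ∃ ψ : A.R →ₗ[ℂ] A.C, A.IsEquivariant (-2 * k + 1) ψ ∧
      ∃ α : ℕ → ℂ, A.HasForm (-2 * k + 1) ψ α ∧ α 0 = 1) ∧
    -- `f ↦ ψ_(2k+1)(f^(2k))` is nonzero, equivariant, of the prescribed form
    A.derivedSplitting k ≠ 0 ∧
    A.IsEquivariant (-2 * k + 1) (A.derivedSplitting k) ∧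
    (∃ α : ℕ → ℂ, A.HasForm (-2 * k + 1) (A.derivedSplitting k) α) ∧
    -- it does not have `α(0) = 1`
    (¬ ∃ α : ℕ → ℂ, A.HasForm (-2 * k + 1) (A.derivedSplitting k) α ∧ α 0 = 1) ∧
    -- and it is, up to a constant, the only map of this kind
    (∀ ψ : A.R →ₗ[ℂ] A.C, A.IsEquivariant (-2 * k + 1) ψ →
      (∃ α : ℕ → ℂ, A.HasForm (-2 * k + 1) ψ α) → ∃ t : ℂ, ψ = t • A.derivedSplitting k) := by
  obtain ⟨γ, hγΓ, hc⟩ := hΓ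
  have hγ : HomographicAlgebra.slope (⟨γ, hγΓ⟩ : Γ) ≠ 0 := hc
  have hno : ¬ ∃ ψ : A.R →ₗ[ℂ] A.C, A.IsEquivariant (-2 * k + 1) ψ ∧
      ∃ α : ℕ → ℂ, A.HasForm (-2 * k + 1) ψ α ∧ α 0 = 1 := by
    rintro ⟨ψ, h, α, rfl, h1⟩
    rw [HomographicAlgebra.coef_eq_zero_of_isEquivariant hk h hγ (by lia)] at h1
    exact zero_ne_one h1
  refine ⟨hno, A.derivedSplitting_ne_zero hγ k, A.isEquivariant_derivedSplitting k,
    ⟨_, A.hasForm_derivedSplitting k⟩,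
    fun h => hno ⟨_, A.isEquivariant_derivedSplitting k, h⟩, ?_⟩
  rintro ψ h ⟨α, rfl⟩
  -- The scalar is read off at index `2k`, where `derivedCoef k` equals `1`.
  refine ⟨α (2 * k), ?_⟩
  rw [A.hasForm_derivedSplitting k, ← A.seriesMap_smul,
    ← HomographicAlgebra.coef_eq_smul_derivedCoef hk h hγ]
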